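/- Let $\mathscr{L}\neq\{0\}$ be a real Hilbert space (for instance of dimension $\aleph_0$), let $(\Omega,\mathcal{F},\mathbb{P})$ be a probability space, and let $\Phi:\mathscr{L}\to L^2(\Omega,\mathcal{F},\mathbb{P})$ be a Gaussian field, i.e. a real linear map such that $(\Phi(h))_{h\in\mathscr{L}}$ is a jointly Gaussian process of real random variables with $\mathbb{E}(\Phi(h))=0$ and $\mathbb{E}(\Phi(h)\Phi(k))=\langle h,k\rangle_{\mathscr{L}}$ for all $h,k\in\mathscr{L}$. Assume that $\mathcal{F}$ is generated by $\{\Phi(h)\mid h\in\mathscr{L}\}$ up to $\mathbb{P}$-null sets. Let $T:L^2(\Omega,\mathbb{P})\to L^2(\Omega,\mathbb{P})\otimes\mathscr{L}=L^2(\Omega\to\mathscr{L},\mathbb{P})$ (real Hilbert spaces) be the Malliavin derivative, with domain $\mathscr{D}$ the space of all $F=p(\Phi(h_1),\dots,\Phi(h_n))$, $n\in\mathbb{N}_0$, $h_1,\dots,h_n\in\mathscr{L}$, $p\in\mathbb{R}[x_1,\dots,x_n]$, and $$T(F)=\sum_{j=1}^n\frac{\partial p}{\partial x_j}(\Phi(h_1),\dots,\Phi(h_n))\otimes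 h_j .$$ Then $T$ is a well-defined, densely defined and closable linear operator; with $\overline{T}$ its closure and $T^*$ its adjoint, the operator $T^*\overline{T}$ in $L^2(\Omega,\mathcal{F},\mathbb{P})$, on its natural domain $\{F\in\mathrm{dom}(\overline{T})\mid\overline{T}F\in\mathrm{dom}(T^*)\}$, is selfadjoint, and $$\mathrm{spec}_{L^2(\mathbb{P})}(T^*\overline{T})=\mathbb{N}_0=\{0,1,2,\dots\}.$$ Here the spectrum is the set of scalars $\lambda$ for which $T^*\overline{T}-\lambda$ has no everywhere defined bounded inverse; the equality holds both for real $\lambda$ in the real space $L^2(\mathbb{P})$ and for complex $\lambda$, for the complexification of $T^*\overline{T}$ in the complex space $L^2(\mathbb{P};\mathbb{C})$. -/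

import Mathlib

open MeasureTheory ProbabilityTheory
open scoped ENNReal

noncomputable section

/-! ### Unbounded operators: composition and spectrum -/

section Unbounded

variable {𝕜 E F G : Type*} [RCLike 𝕜]
  [NormedAddCommGroup E] [NormedSpace 𝕜 E]
  [NormedAddCommGroup F] [NormedSpace 𝕜 F]
  [NormedAddCommGroup G] [NormedSpace 𝕜 G]

/-- The composition `g f` of two partially defined operators on its natural domain
`{x ∈ dom f | f x ∈ dom g}`. -/
def opComp (g : F →ₗ.[𝕜] G) (f : E →ₗ.[𝕜] F) : E →ₗ.[𝕜] G where
  domain :=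
    { carrier := {x | ∃ hx : x ∈ f.domain, f ⟨x, hx⟩ ∈ g.domain}
      zero_mem' := ⟨f.domain.zero_mem, by
        have h : f ⟨0, f.domain.zero_mem⟩ = 0 := f.map_zero
        rw [h]
        exact g.domain.zero_mem⟩
      add_mem' := by
        rintro x y ⟨hx, hx'⟩ ⟨hy, hy'⟩
        refine ⟨f.domain.add_mem hx hy, ?_⟩
        have h := f.map_add ⟨x, hx⟩ ⟨y, hy⟩
        exact h ▸ g.domain.add_mem hx' hy'
      smul_mem' := by
        rintro c x ⟨hx, hx'⟩
        refine ⟨f.domain.smul_mem c hx, ?_⟩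
        have h := f.map_smul c ⟨x, hx⟩
        exact h ▸ g.domain.smul_mem c hx' }
  toFun :=
    { toFun := fun x => g ⟨f ⟨x.1, x.2.1⟩, x.2.2⟩
      map_add' := by
        intro x y
        rw [← g.map_add]
        congr 1
        exact Subtype.ext (f.map_add ⟨x.1, x.2.1⟩ ⟨y.1, y.2.1⟩)
      map_smul' := by
        intro c x
        rw [RingHom.id_apply, ← g.map_smul]
        congr 1
        exact Subtype.ext (f.map_smul c ⟨x.1, x.2.1⟩) }

/-- The resolvent set of a partially defined operator: all `z` for which `A - z : dom A → E`
has an everywhere defined bounded two-sided inverse `R`. -/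
def opResolventSet (A : E →ₗ.[𝕜] E) : Set 𝕜 :=
  {z | ∃ R : E →L[𝕜] E,
      (∀ y : E, ∃ hy : R y ∈ A.domain, A ⟨R y, hy⟩ - z • R y = y) ∧
      ∀ x : A.domain, R (A x - z • (x : E)) = x}

/-- The spectrum of a partially defined operator. -/
def opSpectrum (A : E →ₗ.[𝕜] E) : Set 𝕜 := (opResolventSet A)ᶜ

end Unbounded

/-! ### Complexification of an operator in a real `L²` space -/

section Complexification

variable {Ω : Type*} [MeasurableSpace Ω] (P : Measure Ω)

/-- Pointwise real part `L²(P; ℂ) → L²(P; ℝ)`. -/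
def reL2 : Lp ℂ 2 P →L[ℝ] Lp ℝ 2 P := Complex.reCLM.compLpL 2 P

/-- Pointwise imaginary part `L²(P; ℂ) → L²(P; ℝ)`. -/
def imL2 : Lp ℂ 2 P →L[ℝ] Lp ℝ 2 P := Complex.imCLM.compLpL 2 P

/-- The inclusion `L²(P; ℝ) → L²(P; ℂ)`. -/
def ofRealL2 : Lp ℝ 2 P →L[ℝ] Lp ℂ 2 P := Complex.ofRealCLM.compLpL 2 P

variable {P}

theorem reL2_smul (c : ℂ) (F : Lp ℂ 2 P) :
    reL2 P (c • F) = c.re • reL2 P F - c.im • imL2 P F := by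
  apply Lp.ext
  filter_upwards [Complex.reCLM.coeFn_compLpL (p := 2) (μ := P) (c • F),
    Complex.reCLM.coeFn_compLpL (p := 2) (μ := P) F,
    Complex.imCLM.coeFn_compLpL (p := 2) (μ := P) F, Lp.coeFn_smul c F,
    Lp.coeFn_sub (c.re • reL2 P F) (c.im • imL2 P F), Lp.coeFn_smul c.re (reL2 P F),
    Lp.coeFn_smul c.im (imL2 P F)] with ω h1 h2 h3 h4 h5 h6 h7
  simp only [reL2, imL2, Pi.sub_apply, Pi.smul_apply] at *
  rw [h1, h5, h6, h7, h2, h3, h4]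
  simp

theorem imL2_smul (c : ℂ) (F : Lp ℂ 2 P) :
    imL2 P (c • F) = c.re • imL2 P F + c.im • reL2 P F := by
  apply Lp.ext
  filter_upwards [Complex.imCLM.coeFn_compLpL (p := 2) (μ := P) (c • F),
    Complex.reCLM.coeFn_compLpL (p := 2) (μ := P) F,
    Complex.imCLM.coeFn_compLpL (p := 2) (μ := P) F, Lp.coeFn_smul c F,
    Lp.coeFn_add (c.re • imL2 P F) (c.im • reL2 P F), Lp.coeFn_smul c.re (imL2 P F),
    Lp.coeFn_smul c.im (reL2 P F)] with ω h1 h2 h3 h4 h5 h6 h7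
  simp only [reL2, imL2, Pi.add_apply, Pi.smul_apply] at *
  rw [h1, h5, h6, h7, h2, h3, h4]
  simp

theorem ofRealL2_smul (r : ℝ) (f : Lp ℝ 2 P) : ofRealL2 P (r • f) = (r : ℂ) • ofRealL2 P f := by
  rw [map_smul]
  rfl

theorem smul_add_I_smul {V : Type*} [AddCommGroup V] [Module ℂ V] (c : ℂ) (u v : V) :
    ((c.re : ℂ) • u - (c.im : ℂ) • v) + Complex.I • ((c.re : ℂ) • v + (c.im : ℂ) • u) =
      c • (u + Complex.I • v) := by
  obtain ⟨a, b⟩ := c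
  have hc : (⟨a, b⟩ : ℂ) = (a : ℂ) + (b : ℂ) * Complex.I := (Complex.re_add_im ⟨a, b⟩).symm
  rw [hc]
  match_scalars
  · simp
    ring
  · simp
    linear_combination (-(b : ℂ)) * Complex.I_mul_I

theorem complexify_smul_aux (c : ℂ) (f g : Lp ℝ 2 P) :
    ofRealL2 P (c.re • f - c.im • g) + Complex.I • ofRealL2 P (c.re • g + c.im • f) =
      c • (ofRealL2 P f + Complex.I • ofRealL2 P g) := by
  rw [map_sub, map_add, ofRealL2_smul, ofRealL2_smul, ofRealL2_smul, ofRealL2_smul]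
  exact smul_add_I_smul c _ _

/-- The domain `{F | Re F ∈ D and Im F ∈ D}`. -/
def complexifyDomain (D : Submodule ℝ (Lp ℝ 2 P)) : Submodule ℂ (Lp ℂ 2 P) where
  carrier := {F | reL2 P F ∈ D ∧ imL2 P F ∈ D}
  zero_mem' := by simp
  add_mem' := by
    rintro F G ⟨h1, h2⟩ ⟨h3, h4⟩
    exact ⟨by rw [map_add]; exact D.add_mem h1 h3, by rw [map_add]; exact D.add_mem h2 h4⟩
  smul_mem' := by
    rintro c F ⟨h1, h2⟩
    exact ⟨by rw [reL2_smul]; exact D.sub_mem (D.smul_mem _ h1) (D.smul_mem _ h2),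
      by rw [imL2_smul]; exact D.add_mem (D.smul_mem _ h2) (D.smul_mem _ h1)⟩

/-- Pointwise real part on the complexified domain. -/
def reOn (D : Submodule ℝ (Lp ℝ 2 P)) (F : complexifyDomain D) : D := ⟨reL2 P F.1, F.2.1⟩

/-- Pointwise imaginary part on the complexified domain. -/
def imOn (D : Submodule ℝ (Lp ℝ 2 P)) (F : complexifyDomain D) : D := ⟨imL2 P F.1, F.2.2⟩

theorem reOn_add (D : Submodule ℝ (Lp ℝ 2 P)) (F G : complexifyDomain D) :
    reOn D (F + G) = reOn D F + reOn D G := Subtype.ext (map_add (reL2 P) F.1 G.1)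

theorem imOn_add (D : Submodule ℝ (Lp ℝ 2 P)) (F G : complexifyDomain D) :
    imOn D (F + G) = imOn D F + imOn D G := Subtype.ext (map_add (imL2 P) F.1 G.1)

theorem reOn_smul (D : Submodule ℝ (Lp ℝ 2 P)) (c : ℂ) (F : complexifyDomain D) :
    reOn D (c • F) = c.re • reOn D F - c.im • imOn D F := Subtype.ext (reL2_smul c F.1)

theorem imOn_smul (D : Submodule ℝ (Lp ℝ 2 P)) (c : ℂ) (F : complexifyDomain D) :
    imOn D (c • F) = c.re • imOn D F + c.im • reOn D F := Subtype.ext (imL2_smul c F.1)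

/-- The complexification `F ↦ A (Re F) + i A (Im F)` of an operator `A` in `L²(P; ℝ)`, as an
operator in `L²(P; ℂ)` with domain `{F | Re F ∈ dom A and Im F ∈ dom A}`. -/
def complexify (A : Lp ℝ 2 P →ₗ.[ℝ] Lp ℝ 2 P) : Lp ℂ 2 P →ₗ.[ℂ] Lp ℂ 2 P where
  domain := complexifyDomain A.domain
  toFun :=
    { toFun := fun F => ofRealL2 P (A (reOn A.domain F)) +
        Complex.I • ofRealL2 P (A (imOn A.domain F))
      map_add' := by
        intro F G
        rw [reOn_add, imOn_add, A.map_add, A.map_add, map_add, map_add, smul_add]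
        exact add_add_add_comm _ _ _ _
      map_smul' := by
        intro c F
        rw [reOn_smul, imOn_smul, A.map_sub, A.map_add, A.map_smul, A.map_smul, A.map_smul,
          A.map_smul]
        exact complexify_smul_aux c _ _ }

end Complexification

/-! ### Gaussian fields and the Malliavin derivative -/

section Gaussian

variable {L : Type*} [NormedAddCommGroup L] [InnerProductSpace ℝ L]
  {Ω : Type*} [MeasurableSpace Ω] {P : Measure Ω}

/-- A Gaussian field indexed by the real Hilbert space `L`: a linear map `Φ : L → L²(Ω, P)`
such that `(Φ h)_h` is a centred Gaussian process with covariance `⟪h, k⟫`. -/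
structure IsGaussianField (Φ : L →ₗ[ℝ] Lp ℝ 2 P) : Prop where
  isGaussianProcess : IsGaussianProcess (fun (h : L) (ω : Ω) => Φ h ω) P
  mean_zero : ∀ h : L, ∫ ω, Φ h ω ∂P = 0
  covariance : ∀ h k : L, ∫ ω, Φ h ω * Φ k ω ∂P = inner ℝ h k

/-- The σ-algebra of the probability space is the one generated by the field, up to null sets:
every event agrees almost surely with an event of `σ(Φ h | h ∈ L)`. -/
def GeneratesEvents (Φ : L →ₗ[ℝ] Lp ℝ 2 P) : Prop :=
  ∀ A : Set Ω, MeasurableSet A →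
    ∃ B : Set Ω,
      MeasurableSet[⨆ h : L, MeasurableSpace.comap (fun ω => Φ h ω) (borel ℝ)] B ∧ A =ᵐ[P] B

/-- `F` is the polynomial functional `p (Φ (h 1), …, Φ (h n))`. -/
def IsPolyField (Φ : L →ₗ[ℝ] Lp ℝ 2 P) {n : ℕ} (h : Fin n → L) (p : MvPolynomial (Fin n) ℝ)
    (F : Lp ℝ 2 P) : Prop :=
  (F : Ω → ℝ) =ᵐ[P] fun ω => MvPolynomial.eval (fun i => Φ (h i) ω) p

/-- `ψ` is the `L`-valued random variable `∑ⱼ (∂p/∂xⱼ) (Φ (h 1), …, Φ (h n)) ⊗ h j`, where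
`L²(Ω, P) ⊗ L` is realized as `L²(Ω → L, P)`. -/
def IsPolyFieldDeriv (Φ : L →ₗ[ℝ] Lp ℝ 2 P) {n : ℕ} (h : Fin n → L)
    (p : MvPolynomial (Fin n) ℝ) (ψ : Lp L 2 P) : Prop :=
  (ψ : Ω → L) =ᵐ[P] fun ω =>
    ∑ j, MvPolynomial.eval (fun i => Φ (h i) ω) (MvPolynomial.pderiv j p) • h j

/-- The span of all pairs `(F, T F)` with `F = p (Φ (h 1), …, Φ (h n))` and
`T F = ∑ⱼ (∂p/∂xⱼ) (Φ (h 1), …, Φ (h n)) ⊗ h j`. -/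
def malliavinGraph (Φ : L →ₗ[ℝ] Lp ℝ 2 P) : Submodule ℝ (Lp ℝ 2 P × Lp L 2 P) :=
  Submodule.span ℝ {x | ∃ (n : ℕ) (h : Fin n → L) (p : MvPolynomial (Fin n) ℝ),
    IsPolyField Φ h p x.1 ∧ IsPolyFieldDeriv Φ h p x.2}

/-- The Malliavin derivative `T : L²(Ω, P) → L²(Ω → L, P)`, whose domain is the space of
polynomial functionals: the operator with graph `malliavinGraph Φ`. -/
def malliavin (Φ : L →ₗ[ℝ] Lp ℝ 2 P) : Lp ℝ 2 P →ₗ.[ℝ] Lp L 2 P :=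
  (malliavinGraph Φ).toLinearPMap

/-- The operator `T* T̄` in `L²(Ω, P)`, for the Malliavin derivative `T` with closure `T̄`. -/
def malliavinLaplacian (Φ : L →ₗ[ℝ] Lp ℝ 2 P) : Lp ℝ 2 P →ₗ.[ℝ] Lp ℝ 2 P :=
  opComp (malliavin Φ).adjoint (malliavin Φ).closure

end Gaussian

end

/-! The operator `N = T* T̄` is diagonalised by polynomials. Everything rests on Gaussian
integration by parts: for polynomial functionals, the derivative `∂ₖ` in direction `k` has the
formal adjoint `δₖ g = Φ(k) g - ∂ₖ g` (`IsGaussianField.integral_dirDeriv_mul`). This makes `T` well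
defined, since `p(Φ) = 0` forces `E[(∂ₖp)²] = E[p δₖ∂ₖp] = 0`, and it gives `T*(g ⊗ k) = δₖ g`.
Polynomials are total in `L²` because the field generates the events, so `T` and `T*` are densely
defined and `T` is closable.

On a homogeneous polynomial of degree `d`, Euler's identity gives `N q = d q - R q`, where `R`
lowers the degree by two. Thus `N` is triangular with diagonal entries `d`, and every polynomial is
a sum of eigenvectors with eigenvalues in `ℕ`. The Hermite polynomials in one unit direction show
that each `n` is an eigenvalue.

The rest is abstract: `N` is symmetric and closed (von Neumann's argument), and a symmetric closed
operator whose eigenvectors for eigenvalues in `ℕ` have dense span is selfadjoint, with the spectrum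
inside the closed set `ℕ`. These properties pass to the complexification through real and imaginary
parts. -/

noncomputable section

/-! ### Closed symmetric operators with a dense span of eigenvectors -/

section DiagonalOperator

variable {𝕜 E F : Type*} [RCLike 𝕜]
  [NormedAddCommGroup E] [InnerProductSpace 𝕜 E] [NormedAddCommGroup F] [InnerProductSpace 𝕜 F]

theorem mem_graph_opComp_iff {G : Type*} [NormedAddCommGroup G] [NormedSpace 𝕜 G]
    (g : F →ₗ.[𝕜] G) (f : E →ₗ.[𝕜] F) (x : E) (y : G) :
    (x, y) ∈ (opComp g f).graph ↔ ∃ w, (x, w) ∈ f.graph ∧ (w, y) ∈ g.graph := by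
  simp only [LinearPMap.mem_graph_iff]
  constructor
  · rintro ⟨u, rfl, rfl⟩
    exact ⟨f ⟨u.1, u.2.1⟩, ⟨⟨u.1, u.2.1⟩, rfl, rfl⟩, ⟨⟨_, u.2.2⟩, rfl, rfl⟩⟩
  · rintro ⟨w, ⟨a, rfl, rfl⟩, ⟨b, hb, rfl⟩⟩
    refine ⟨⟨a, a.2, by rw [← show (b : F) = f a from hb]; exact b.2⟩, rfl, ?_⟩
    change g _ = g b
    congr 1
    exact Subtype.ext hb.symm

/-- The eigenspace of a partially defined operator for the eigenvalue `z`. -/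
def opEigenspace (A : E →ₗ.[𝕜] E) (z : 𝕜) : Submodule 𝕜 E :=
  A.graph.comap (LinearMap.id.prod (z • LinearMap.id))

theorem mem_opEigenspace {A : E →ₗ.[𝕜] E} {z : 𝕜} {x : E} :
    x ∈ opEigenspace A z ↔ (x, z • x) ∈ A.graph := Iff.rfl

theorem inner_graph_eq {A : E →ₗ.[𝕜] F} {B : F →ₗ.[𝕜] E} (hA : A.IsFormalAdjoint B)
    {x w : _} {y v : _} (hx : (x, w) ∈ A.graph) (hy : (y, v) ∈ B.graph) :
    inner 𝕜 w y = inner 𝕜 x v := by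
  rw [LinearPMap.mem_graph_iff] at hx hy
  obtain ⟨a, rfl, rfl⟩ := hx
  obtain ⟨b, rfl, rfl⟩ := hy
  exact hA a b

theorem orthogonalFamily_opEigenspace {A : E →ₗ.[𝕜] E} (hA : A.IsFormalAdjoint A) :
    OrthogonalFamily 𝕜 (fun n : ℕ => opEigenspace A (n : 𝕜))
      (fun n => (opEigenspace A (n : 𝕜)).subtypeₗᵢ) := by
  intro m n hmn x y
  have h := inner_graph_eq hA (mem_opEigenspace.1 x.2) (mem_opEigenspace.1 y.2)
  rw [inner_smul_left, inner_smul_right, map_natCast, ← sub_eq_zero, ← sub_mul, mul_eq_zero,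
    sub_eq_zero, Nat.cast_inj] at h
  exact h.resolve_left hmn

theorem exists_finsupp_of_mem_iSup_opEigenspace {A : E →ₗ.[𝕜] E} {x : E}
    (hx : x ∈ ⨆ n : ℕ, opEigenspace A (n : 𝕜)) :
    ∃ (s : Finset ℕ) (f : (n : ℕ) → opEigenspace A (n : 𝕜)), x = ∑ n ∈ s, (f n : E) := by
  obtain ⟨f, hf, rfl⟩ := (Submodule.mem_iSup_iff_exists_finsupp _ _).1 hx
  exact ⟨f.support, fun n => ⟨f n, hf n⟩, rfl⟩

theorem sum_mem_graph {A : E →ₗ.[𝕜] E} (s : Finset ℕ)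
    (f : (n : ℕ) → opEigenspace A (n : 𝕜)) :
    (∑ n ∈ s, (f n : E), ∑ n ∈ s, (n : 𝕜) • (f n : E)) ∈ A.graph := by
  have h : ∑ n ∈ s, ((f n : E), (n : 𝕜) • (f n : E)) ∈ A.graph :=
    Submodule.sum_mem _ fun n _ => mem_opEigenspace.1 (f n).2
  convert h using 1
  refine Prod.ext ?_ ?_
  · rw [Prod.fst_sum]
  · rw [Prod.snd_sum]

theorem sum_mem_iSup_opEigenspace {A : E →ₗ.[𝕜] E} (s : Finset ℕ)
    (f : (n : ℕ) → opEigenspace A (n : 𝕜)) :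
    ∑ n ∈ s, (f n : E) ∈ ⨆ n : ℕ, opEigenspace A (n : 𝕜) :=
  Submodule.sum_mem _ fun n _ => Submodule.mem_iSup_of_mem n (f n).2

/-- Pythagoras: on the component with eigenvalue `n`, `A - z` is multiplication by `n - z`, and the
components are orthogonal. -/
theorem norm_le_of_mem_iSup_opEigenspace {A : E →ₗ.[𝕜] E} (hA : A.IsFormalAdjoint A)
    {z : 𝕜} {δ : ℝ} (hδ : 0 < δ) (hz : ∀ n : ℕ, δ ≤ ‖(n : 𝕜) - z‖) {x w : E}
    (hx : x ∈ ⨆ n : ℕ, opEigenspace A (n : 𝕜)) (hw : (x, w) ∈ A.graph) :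
    δ * ‖x‖ ≤ ‖w - z • x‖ := by
  obtain ⟨s, f, rfl⟩ := exists_finsupp_of_mem_iSup_opEigenspace hx
  have hw' : w = ∑ n ∈ s, (n : 𝕜) • (f n : E) :=
    LinearPMap.mem_graph_snd_inj' A hw (sum_mem_graph s f) rfl
  have hV := orthogonalFamily_opEigenspace hA
  have h1 := hV.norm_sum f s
  have h2 := hV.norm_sum (fun n => ((n : 𝕜) - z) • f n) s
  simp only [Submodule.coe_subtypeₗᵢ, Submodule.subtype_apply, Submodule.coe_smul] at h1 h2
  have h3 : w - z • ∑ n ∈ s, (f n : E) = ∑ n ∈ s, ((n : 𝕜) - z) • (f n : E) := by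
    rw [hw', Finset.smul_sum, ← Finset.sum_sub_distrib]
    exact Finset.sum_congr rfl fun n _ => (sub_smul _ _ _).symm
  rw [h3]
  refine (sq_le_sq₀ (by positivity) (norm_nonneg _)).1 ?_
  rw [mul_pow, h1, h2, Finset.mul_sum]
  refine Finset.sum_le_sum fun n _ => ?_
  rw [norm_smul, mul_pow]
  gcongr
  exact hz n

theorem exists_mem_iSup_opEigenspace_sub_eq {A : E →ₗ.[𝕜] E} {z : 𝕜}
    (hz : ∀ n : ℕ, (n : 𝕜) - z ≠ 0) {y : E} (hy : y ∈ ⨆ n : ℕ, opEigenspace A (n : 𝕜)) :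
    ∃ x ∈ ⨆ n : ℕ, opEigenspace A (n : 𝕜), (x, z • x + y) ∈ A.graph := by
  obtain ⟨s, f, rfl⟩ := exists_finsupp_of_mem_iSup_opEigenspace hy
  refine ⟨_, sum_mem_iSup_opEigenspace s fun n => ((n : 𝕜) - z)⁻¹ • f n, ?_⟩
  convert sum_mem_graph s fun n => ((n : 𝕜) - z)⁻¹ • f n using 2
  rw [Finset.smul_sum, ← Finset.sum_add_distrib]
  refine Finset.sum_congr rfl fun n _ => ?_
  rw [Submodule.coe_smul]
  have : (f n : E) = ((n : 𝕜) - z) • ((n : 𝕜) - z)⁻¹ • (f n : E) := by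
    rw [smul_smul, mul_inv_cancel₀ (hz n), one_smul]
  nth_rewrite 2 [this]
  rw [← add_smul, add_sub_cancel]

/-- The equation is solved componentwise on the dense span. The lower bound makes the solutions of
approximating equations Cauchy, and closedness of `A` puts their limit in the graph. -/
theorem exists_resolvent_graph [CompleteSpace E] {A : E →ₗ.[𝕜] E} (hA : A.IsFormalAdjoint A)
    (hcl : A.IsClosed) (hd : Dense ((⨆ n : ℕ, opEigenspace A (n : 𝕜) : Submodule 𝕜 E) : Set E))
    {z : 𝕜} {δ : ℝ} (hδ : 0 < δ) (hz : ∀ n : ℕ, δ ≤ ‖(n : 𝕜) - z‖) (y : E) :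
    ∃ x, (x, z • x + y) ∈ A.graph ∧ δ * ‖x‖ ≤ ‖y‖ := by
  have hz0 : ∀ n : ℕ, (n : 𝕜) - z ≠ 0 := fun n => norm_pos_iff.1 (hδ.trans_le (hz n))
  obtain ⟨v, hv, hvy⟩ := mem_closure_iff_seq_limit.1 (hd y)
  choose u hu huv using fun n => exists_mem_iSup_opEigenspace_sub_eq hz0 (hv n)
  have hb : ∀ m n, δ * ‖u m - u n‖ ≤ ‖v m - v n‖ := fun m n => by
    have h := norm_le_of_mem_iSup_opEigenspace hA hδ hz (Submodule.sub_mem _ (hu m) (hu n))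
      (A.graph.sub_mem (huv m) (huv n))
    convert h using 2
    simp only [smul_sub]
    abel
  have hc : CauchySeq u := by
    rw [Metric.cauchySeq_iff']
    intro ε hε
    obtain ⟨N, hN⟩ := Metric.cauchySeq_iff'.1 hvy.cauchySeq (δ * ε) (by positivity)
    refine ⟨N, fun n hn => ?_⟩
    have h1 := hN n hn
    rw [dist_eq_norm] at h1 ⊢
    exact lt_of_mul_lt_mul_left ((hb n N).trans_lt h1) hδ.le
  obtain ⟨x, hx⟩ := cauchySeq_tendsto_of_complete hc
  have hlim := hx.prodMk_nhds ((hx.const_smul z).add hvy)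
  refine ⟨x, hcl.mem_of_tendsto hlim (Filter.Eventually.of_forall huv), ?_⟩
  refine le_of_tendsto_of_tendsto' (hx.norm.const_mul δ) hvy.norm fun n => ?_
  have h := norm_le_of_mem_iSup_opEigenspace hA hδ hz (hu n) (huv n)
  rwa [add_sub_cancel_left] at h

/-- A vector in the kernel of `A - z` is orthogonal to the range of `A - z̄`, which contains the
dense span. -/
theorem eq_zero_of_mem_graph_smul {A : E →ₗ.[𝕜] E} (hA : A.IsFormalAdjoint A)
    (hd : Dense ((⨆ n : ℕ, opEigenspace A (n : 𝕜) : Submodule 𝕜 E) : Set E))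
    {z : 𝕜} (hz : ∀ n : ℕ, (n : 𝕜) - z ≠ 0) {x : E} (hx : (x, z • x) ∈ A.graph) : x = 0 := by
  refine hd.eq_zero_of_inner_left 𝕜 fun y hy => ?_
  have hz' : ∀ n : ℕ, (n : 𝕜) - starRingEnd 𝕜 z ≠ 0 := fun n h => hz n <| by
    have := congrArg (starRingEnd 𝕜) h
    simpa using this
  obtain ⟨u, -, hu⟩ := exists_mem_iSup_opEigenspace_sub_eq hz' hy
  have h := inner_graph_eq hA hx hu
  rw [inner_smul_left, inner_add_right, inner_smul_right] at h
  simpa using h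

theorem mem_opResolventSet_of_dense_eigenspaces [CompleteSpace E] {A : E →ₗ.[𝕜] E}
    (hA : A.IsFormalAdjoint A) (hcl : A.IsClosed)
    (hd : Dense ((⨆ n : ℕ, opEigenspace A (n : 𝕜) : Submodule 𝕜 E) : Set E))
    {z : 𝕜} {δ : ℝ} (hδ : 0 < δ) (hz : ∀ n : ℕ, δ ≤ ‖(n : 𝕜) - z‖) :
    z ∈ opResolventSet A := by
  have hz0 : ∀ n : ℕ, (n : 𝕜) - z ≠ 0 := fun n => norm_pos_iff.1 (hδ.trans_le (hz n))
  choose R hR hRb using exists_resolvent_graph hA hcl hd hδ hz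
  -- Uniqueness of solutions yields both the linearity of `R` and the left inverse property.
  have huniq : ∀ {x y : E}, (x, z • x + y) ∈ A.graph → R y = x := fun {x y} hx => by
    have h := A.graph.sub_mem (hR y) hx
    rw [← sub_eq_zero]
    refine eq_zero_of_mem_graph_smul hA hd hz0 (z := z) ?_
    convert h using 1
    simp only [smul_sub, Prod.mk_sub_mk]
    congr 1
    abel
  let R' : E →ₗ[𝕜] E :=
    { toFun := R
      map_add' := fun y y' => huniq <| by
        convert A.graph.add_mem (hR y) (hR y') using 1
        simp only [Prod.mk_add_mk, smul_add]
        congr 1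
        abel
      map_smul' := fun c y => huniq <| by
        convert A.graph.smul_mem c (hR y) using 1
        simp only [Prod.smul_mk, smul_add, RingHom.id_apply, smul_comm c z] }
  refine ⟨R'.mkContinuous δ⁻¹ fun y => ?_, fun y => ?_, fun x => ?_⟩
  · rw [inv_mul_eq_div, le_div_iff₀' hδ]
    exact hRb y
  · obtain ⟨a, ha, ha'⟩ := (LinearPMap.mem_graph_iff A).1 (hR y)
    have ha0 : (a : E) = R y := ha
    have hy : R y ∈ A.domain := ha0 ▸ a.2
    refine ⟨hy, ?_⟩
    have : (⟨R y, hy⟩ : A.domain) = a := Subtype.ext ha0.symm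
    change A ⟨R y, _⟩ - z • R y = y
    rw [this, ha', add_sub_cancel_left]
  · refine huniq ?_
    rw [add_sub_cancel]
    exact A.mem_graph x

theorem opEigenspace_eq_bot_of_mem_opResolventSet {A : E →ₗ.[𝕜] E} {z : 𝕜}
    (hz : z ∈ opResolventSet A) : opEigenspace A z = ⊥ := by
  obtain ⟨R, -, hR⟩ := hz
  rw [Submodule.eq_bot_iff]
  intro x hx
  obtain ⟨a, ha, ha'⟩ := (LinearPMap.mem_graph_iff A).1 (mem_opEigenspace.1 hx)
  have h := hR a
  dsimp only at ha ha'
  rw [ha', ha, sub_self, map_zero] at h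
  exact h.symm

/-- `ℕ` is embedded isometrically, hence with closed range, so a point off it has positive distance
to it. -/
theorem exists_le_norm_natCast_sub {z : 𝕜} (hz : z ∉ Set.range (fun n : ℕ => (n : 𝕜))) :
    ∃ δ : ℝ, 0 < δ ∧ ∀ n : ℕ, δ ≤ ‖(n : 𝕜) - z‖ := by
  have hiso : Isometry (fun n : ℕ => (n : 𝕜)) := Isometry.of_dist_eq fun m n => by
    rw [dist_eq_norm, Nat.dist_eq, ← RCLike.norm_ofReal (K := 𝕜)]
    push_cast
    rfl
  have hcl : IsClosed (Set.range (fun n : ℕ => (n : 𝕜))) := hiso.isClosedEmbedding.isClosed_range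
  obtain ⟨δ, hδ, h⟩ := Metric.isOpen_iff.1 hcl.isOpen_compl z hz
  refine ⟨δ, hδ, fun n => ?_⟩
  by_contra! hn
  refine h (Metric.mem_ball.2 ?_) ⟨n, rfl⟩
  rwa [dist_eq_norm]

theorem opSpectrum_eq_range_natCast [CompleteSpace E] {A : E →ₗ.[𝕜] E}
    (hA : A.IsFormalAdjoint A) (hcl : A.IsClosed)
    (hd : Dense ((⨆ n : ℕ, opEigenspace A (n : 𝕜) : Submodule 𝕜 E) : Set E))
    (hne : ∀ n : ℕ, opEigenspace A (n : 𝕜) ≠ ⊥) :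
    opSpectrum A = Set.range (fun n : ℕ => (n : 𝕜)) := by
  refine Set.Subset.antisymm (fun z hz => ?_) ?_
  · by_contra hz'
    obtain ⟨δ, hδ, h⟩ := exists_le_norm_natCast_sub hz'
    exact hz (mem_opResolventSet_of_dense_eigenspaces hA hcl hd hδ h)
  · rintro _ ⟨n, rfl⟩ h
    exact hne n (opEigenspace_eq_bot_of_mem_opResolventSet h)

theorem iSup_opEigenspace_le_domain (A : E →ₗ.[𝕜] E) :
    ⨆ n : ℕ, opEigenspace A (n : 𝕜) ≤ A.domain :=
  iSup_le fun _ _ hx => LinearPMap.mem_domain_of_mem_graph (mem_opEigenspace.1 hx)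

/-- Only `dom A* ⊆ dom A` needs proof. For `y` in `dom A*`, solve `(A + 1) x = (A* + 1) y`; then `x
- y` is orthogonal to the range of `A + 1`, which contains the dense span, so `y = x` lies in `dom
A`. -/
theorem isSelfAdjoint_of_dense_eigenspaces [CompleteSpace E] {A : E →ₗ.[𝕜] E}
    (hA : A.IsFormalAdjoint A) (hcl : A.IsClosed)
    (hd : Dense ((⨆ n : ℕ, opEigenspace A (n : 𝕜) : Submodule 𝕜 E) : Set E)) :
    IsSelfAdjoint A := by
  have hdom : Dense (A.domain : Set E) := hd.mono (iSup_opEigenspace_le_domain A)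
  have hle : A ≤ A.adjoint := LinearPMap.IsFormalAdjoint.le_adjoint hdom hA
  rw [LinearPMap.isSelfAdjoint_def]
  refine (LinearPMap.eq_of_le_of_domain_eq hle (le_antisymm hle.1 fun y hy => ?_)).symm
  have hz : ∀ n : ℕ, (1 : ℝ) ≤ ‖(n : 𝕜) - (-1)‖ := fun n => by
    have : (n : 𝕜) - (-1) = ((n + 1 : ℕ) : 𝕜) := by push_cast; ring
    rw [this, RCLike.norm_natCast]
    simp
  obtain ⟨x, hx, -⟩ :=
    exists_resolvent_graph hA hcl hd one_pos hz (A.adjoint ⟨y, hy⟩ + y)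
  suffices x = y from this ▸ LinearPMap.mem_domain_of_mem_graph hx
  rw [← sub_eq_zero]
  refine hd.eq_zero_of_inner_left 𝕜 fun w hw => ?_
  obtain ⟨u, -, hu⟩ := exists_mem_iSup_opEigenspace_sub_eq
    (fun n => norm_pos_iff.1 (one_pos.trans_le (hz n))) hw
  have h1 := inner_graph_eq hA hx hu
  have h2 := inner_graph_eq (LinearPMap.adjoint_isFormalAdjoint hdom)
    (A.adjoint.mem_graph ⟨y, hy⟩) hu
  simp only [inner_add_left, inner_add_right, neg_smul, one_smul, inner_neg_left,
    inner_neg_right] at h1 h2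
  rw [inner_sub_left]
  linear_combination h2 - h1

end DiagonalOperator

/-! ### Symmetry and closedness of `T* T̄` -/

section VonNeumann

variable {𝕜 E F : Type*} [RCLike 𝕜]
  [NormedAddCommGroup E] [InnerProductSpace 𝕜 E] [NormedAddCommGroup F] [InnerProductSpace 𝕜 F]
  [CompleteSpace E] {T : E →ₗ.[𝕜] F}

/-- For fixed `y` the adjoint identity is a closed condition on graph pairs, so it extends from the
graph of `T` to its closure. -/
theorem closure_isFormalAdjoint_adjoint (hT : Dense (T.domain : Set E)) (hc : T.IsClosable) :
    T.closure.IsFormalAdjoint T.adjoint := by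
  intro x y
  have hx : ((x : E), T.closure x) ∈ closure (T.graph : Set (E × F)) := by
    have := T.closure.mem_graph x
    rw [← hc.graph_closure_eq_closure_graph] at this
    exact this
  have hcl : IsClosed {q : E × F | inner 𝕜 q.2 (y : F) = inner 𝕜 q.1 (T.adjoint y)} :=
    isClosed_eq (by fun_prop) (by fun_prop)
  refine closure_minimal (fun q hq => ?_) hcl hx
  exact inner_graph_eq (LinearPMap.adjoint_isFormalAdjoint hT).symm hq (T.adjoint.mem_graph y)

theorem opComp_adjoint_isFormalAdjoint (hT : Dense (T.domain : Set E)) (hc : T.IsClosable) :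
    (opComp T.adjoint T.closure).IsFormalAdjoint (opComp T.adjoint T.closure) := by
  have h := closure_isFormalAdjoint_adjoint hT hc
  intro x y
  exact (h.symm ⟨_, x.2.2⟩ ⟨y, y.2.1⟩).trans (h ⟨x, x.2.1⟩ ⟨_, y.2.2⟩)

theorem opComp_adjoint_isClosed [CompleteSpace F] (hT : Dense (T.domain : Set E))
    (hc : T.IsClosable) : (opComp T.adjoint T.closure).IsClosed := by
  have h := closure_isFormalAdjoint_adjoint hT hc
  refine IsSeqClosed.isClosed fun q p hq hqp => ?_
  choose w hw hw' using fun n => (mem_graph_opComp_iff _ _ (q n).1 (q n).2).1 (hq n)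
  have h1 : Filter.Tendsto (fun n => (q n).1) Filter.atTop (nhds p.1) :=
    (continuous_fst.tendsto p).comp hqp
  have h2 : Filter.Tendsto (fun n => (q n).2) Filter.atTop (nhds p.2) :=
    (continuous_snd.tendsto p).comp hqp
  -- `‖T̄x‖² = ⟪x, T*T̄x⟫`, so convergence of `x` and `T*T̄x` forces the intermediate vectors `w =
  -- T̄x` to be Cauchy.
  have hb : ∀ m n, ‖w m - w n‖ ^ 2 ≤ ‖(q m).1 - (q n).1‖ * ‖(q m).2 - (q n).2‖ := fun m n => by
    have := inner_graph_eq h (T.closure.graph.sub_mem (hw m) (hw n))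
      (T.adjoint.graph.sub_mem (hw' m) (hw' n))
    dsimp only at this
    rw [← inner_self_eq_norm_sq (𝕜 := 𝕜), this]
    exact (RCLike.re_le_norm _).trans (norm_inner_le_norm _ _)
  have hcau : CauchySeq w := by
    rw [Metric.cauchySeq_iff']
    intro ε hε
    obtain ⟨N1, hN1⟩ := Metric.cauchySeq_iff.1 h1.cauchySeq ε hε
    obtain ⟨N2, hN2⟩ := Metric.cauchySeq_iff.1 h2.cauchySeq ε hε
    refine ⟨max N1 N2, fun n hn => ?_⟩
    have e1 := hN1 n ((le_max_left _ _).trans hn) _ (le_max_left N1 N2)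
    have e2 := hN2 n ((le_max_right _ _).trans hn) _ (le_max_right N1 N2)
    rw [dist_eq_norm] at e1 e2 ⊢
    refine lt_of_pow_lt_pow_left₀ 2 hε.le ((hb _ _).trans_lt ?_)
    rw [sq]
    exact mul_lt_mul'' e1 e2 (norm_nonneg _) (norm_nonneg _)
  obtain ⟨v, hv⟩ := cauchySeq_tendsto_of_complete hcau
  refine (mem_graph_opComp_iff _ _ p.1 p.2).2 ⟨v, ?_, ?_⟩
  · exact hc.closure_isClosed.mem_of_tendsto (h1.prodMk_nhds hv) (Filter.Eventually.of_forall hw)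
  · exact (LinearPMap.adjoint_isClosed hT).mem_of_tendsto (hv.prodMk_nhds h2)
      (Filter.Eventually.of_forall hw')

/-- `T` is contained in the closed operator `T**`. -/
theorem isClosable_of_dense_adjoint [CompleteSpace F] (hT : Dense (T.domain : Set E))
    (hT' : Dense (T.adjoint.domain : Set F)) : T.IsClosable :=
  (LinearPMap.adjoint_isClosed hT').isClosable.leIsClosable
    (LinearPMap.IsFormalAdjoint.le_adjoint hT' (LinearPMap.adjoint_isFormalAdjoint hT))

theorem mem_graph_adjoint_of_forall (hT : Dense (T.domain : Set E)) {y : F} {v : E}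
    (h : ∀ x w, (x, w) ∈ T.graph → inner 𝕜 v x = inner 𝕜 y w) : (y, v) ∈ T.adjoint.graph := by
  have h' : ∀ x : T.domain, inner 𝕜 v (x : E) = inner 𝕜 y (T x) := fun x => h _ _ (T.mem_graph x)
  have hy : y ∈ T.adjoint.domain := LinearPMap.mem_adjoint_domain_of_exists y ⟨v, h'⟩
  rw [LinearPMap.mem_graph_iff]
  exact ⟨⟨y, hy⟩, rfl, LinearPMap.adjoint_apply_eq hT _ h'⟩

end VonNeumann

/-! ### One-dimensional Gaussian integration by parts -/

section StandardGaussianMoments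

theorem integrable_pow_gaussianReal (m : ℕ) :
    Integrable (fun x : ℝ => x ^ m) (gaussianReal 0 1) := by
  rcases eq_or_ne m 0 with rfl | hm
  · simp
  · have h := (memLp_id_gaussianReal' (μ := 0) (v := 1) m (by simp)).integrable_norm_pow hm
    refine (integrable_norm_iff (by fun_prop)).1 ?_
    simpa [norm_pow] using h

/-- The density satisfies `φ' = -xφ`, and the derivative of `φ xᵐ` has integral zero. For `m = 0`
the truncated exponent is harmless because its coefficient vanishes. -/
theorem integral_mul_pow_gaussianReal (m : ℕ) :
    ∫ x, x * x ^ m ∂(gaussianReal 0 1) = m * ∫ x, x ^ (m - 1) ∂(gaussianReal 0 1) := by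
  have hint : ∀ j : ℕ, Integrable (fun x : ℝ => gaussianPDFReal 0 1 x * x ^ j) := fun j => by
    have h := integrable_pow_gaussianReal j
    rw [gaussianReal_of_var_ne_zero _ one_ne_zero, integrable_withDensity_iff_integrable_smul'
      (measurable_gaussianPDF 0 1) (Filter.Eventually.of_forall fun _ => gaussianPDF_lt_top)] at h
    simpa [toReal_gaussianPDF] using h
  have hpdf : ∀ x, HasDerivAt (gaussianPDFReal 0 1) (-x * gaussianPDFReal 0 1 x) x := fun x => by
    have h1 : HasDerivAt (fun y : ℝ => -(y - 0) ^ 2 / (2 * ((1 : NNReal) : ℝ))) (-x) x := by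
      have := (((hasDerivAt_id x).sub_const 0).pow 2).neg.div_const (2 * ((1 : NNReal) : ℝ))
      refine this.congr_deriv ?_
      simp
      ring
    have h2 := h1.exp.const_mul (Real.sqrt (2 * Real.pi * ((1 : NNReal) : ℝ)))⁻¹
    rw [gaussianPDFReal_def]
    refine h2.congr_deriv ?_
    ring
  have h0 := integral_eq_zero_of_hasDerivAt_of_integrable
    (f := fun x => gaussianPDFReal 0 1 x * x ^ m)
    (f' := fun x => m * (gaussianPDFReal 0 1 x * x ^ (m - 1)) - gaussianPDFReal 0 1 x * x ^ (m + 1))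
    (fun x => by
      refine ((hpdf x).mul (hasDerivAt_pow m x)).congr_deriv ?_
      ring) (((hint _).const_mul _).sub (hint _)) (hint m)
  rw [integral_sub ((hint _).const_mul _) (hint _), integral_const_mul] at h0
  simp only [integral_gaussianReal_eq_integral_smul one_ne_zero, smul_eq_mul]
  simp only [← pow_succ']
  linarith

end StandardGaussianMoments

/-! ### Integration by parts for polynomials of the field -/

section PolynomialFunctionals

variable {L : Type*} [NormedAddCommGroup L] [InnerProductSpace ℝ L]
  {Ω : Type*} [MeasurableSpace Ω] {P : Measure Ω}

/-- The polynomial functional of the field with polynomial `p` in variables indexed by `L`. -/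
def polyEval (Φ : L →ₗ[ℝ] Lp ℝ 2 P) (p : MvPolynomial L ℝ) (ω : Ω) : ℝ :=
  MvPolynomial.eval (fun l => Φ l ω) p

/-- The derivative in direction `k` of polynomials in variables indexed by `L`. -/
def dirDeriv (k : L) : Derivation ℝ (MvPolynomial L ℝ) (MvPolynomial L ℝ) :=
  MvPolynomial.mkDerivation ℝ fun l => MvPolynomial.C (inner ℝ l k)

/-- The formal adjoint of the derivative in direction `k` with respect to the Gaussian law. -/
def divergence (k : L) (p : MvPolynomial L ℝ) : MvPolynomial L ℝ :=
  MvPolynomial.X k * p - dirDeriv k p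

@[simp]
theorem dirDeriv_X (k l : L) :
    dirDeriv k (MvPolynomial.X l) = (MvPolynomial.C (inner ℝ l k) : MvPolynomial L ℝ) :=
  MvPolynomial.mkDerivation_X ..

@[simp]
theorem dirDeriv_C (k : L) (r : ℝ) : dirDeriv k (MvPolynomial.C r : MvPolynomial L ℝ) = 0 :=
  (dirDeriv k).map_algebraMap r

theorem dirDeriv_smul (c : ℝ) (k : L) (p : MvPolynomial L ℝ) :
    dirDeriv (c • k) p = c • dirDeriv k p := by
  have : dirDeriv (c • k) = c • dirDeriv k := MvPolynomial.derivation_ext fun l => by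
    simp [inner_smul_right, MvPolynomial.smul_eq_C_mul]
  rw [this]
  rfl

/-- The commutator is again a derivation, and it kills the variables because their first derivatives
are constants. -/
theorem dirDeriv_comm (h k : L) (p : MvPolynomial L ℝ) :
    dirDeriv h (dirDeriv k p) = dirDeriv k (dirDeriv h p) := by
  have : ⁅dirDeriv h, dirDeriv k⁆ = 0 := MvPolynomial.derivation_ext fun l => by
    simp [Derivation.commutator_apply]
  have h' := congrArg (fun D => D p) this
  simpa [Derivation.commutator_apply, sub_eq_zero] using h'

variable (Φ : L →ₗ[ℝ] Lp ℝ 2 P)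

@[simp]
theorem polyEval_X (l : L) : polyEval Φ (MvPolynomial.X l) = fun ω => Φ l ω := by
  ext; simp [polyEval]

@[simp]
theorem polyEval_C (r : ℝ) : polyEval Φ (MvPolynomial.C r) = fun _ => r := by
  ext; simp [polyEval]

theorem polyEval_add (p q : MvPolynomial L ℝ) : polyEval Φ (p + q) = polyEval Φ p + polyEval Φ q := by
  ext; simp [polyEval]

theorem polyEval_sub (p q : MvPolynomial L ℝ) : polyEval Φ (p - q) = polyEval Φ p - polyEval Φ q := by
  ext; simp [polyEval]

theorem polyEval_mul (p q : MvPolynomial L ℝ) : polyEval Φ (p * q) = polyEval Φ p * polyEval Φ q := by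
  ext; simp [polyEval]

theorem polyEval_smul (c : ℝ) (p : MvPolynomial L ℝ) :
    polyEval Φ (c • p) = c • polyEval Φ p := by
  ext; simp [polyEval]

theorem polyEval_sum {ι : Type*} (s : Finset ι) (p : ι → MvPolynomial L ℝ) :
    polyEval Φ (∑ i ∈ s, p i) = ∑ i ∈ s, polyEval Φ (p i) := by
  ext; simp [polyEval]

variable {Φ}

theorem IsGaussianField.memLp_polyEval (hΦ : IsGaussianField Φ) (p : MvPolynomial L ℝ)
    {q : ℝ≥0∞} (hq : q ≠ ∞) : MemLp (polyEval Φ p) q P := by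
  have := hΦ.isGaussianProcess.isProbabilityMeasure
  induction p using MvPolynomial.induction_on generalizing q with
  | C a => simpa using memLp_const a
  | add p p' hp hp' => rw [polyEval_add]; exact (hp hq).add (hp' hq)
  | mul_X p l hp =>
    -- Hölder bounds the product in `L^q` by factors in `L^{2q}`; hence the induction runs over all
    -- finite exponents at once.
    have h2 : 2 * q ≠ ∞ := ENNReal.mul_ne_top (by simp) hq
    have hh : ENNReal.HolderTriple (2 * q) (2 * q) q := ⟨by
      rw [ENNReal.mul_inv (by simp) (by simp), ← add_mul, ENNReal.inv_two_add_inv_two, one_mul]⟩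
    rw [polyEval_mul, polyEval_X]
    exact MemLp.mul (p := 2 * q) (q := 2 * q)
      ((hΦ.isGaussianProcess.hasGaussianLaw_eval l).memLp h2) (hp h2)

theorem IsGaussianField.integrable_polyEval (hΦ : IsGaussianField Φ) (p : MvPolynomial L ℝ) :
    Integrable (polyEval Φ p) P :=
  memLp_one_iff_integrable.1 (hΦ.memLp_polyEval p (by simp))

theorem IsGaussianField.map_eq_gaussianReal (hΦ : IsGaussianField Φ) (h : L) :
    P.map (fun ω => Φ h ω) = gaussianReal 0 (‖h‖ ^ 2).toNNReal := by
  have hg := hΦ.isGaussianProcess.hasGaussianLaw_eval h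
  have := hΦ.isGaussianProcess.isProbabilityMeasure
  have h1 := hg.map_eq_gaussianReal
  rw [variance_of_integral_eq_zero hg.aemeasurable (hΦ.mean_zero h), hΦ.mean_zero h] at h1
  have h2 := hΦ.covariance h h
  rw [real_inner_self_eq_norm_sq] at h2
  rw [h1, ← h2]
  simp only [sq]

/-- For jointly Gaussian variables, vanishing covariance implies independence; here the second
family is the whole field on `k^⊥`. -/
theorem IsGaussianField.indepFun_orthogonal (hΦ : IsGaussianField Φ) (k : L) :
    IndepFun (fun ω => Φ k ω) (fun ω (s : {l : L // inner ℝ l k = 0}) => Φ s ω) P := by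
  have hm : ∀ l, Measurable fun ω => Φ l ω := fun l => (Lp.stronglyMeasurable _).measurable
  have := hΦ.isGaussianProcess.isProbabilityMeasure
  have hproc : IsGaussianProcess (Sum.elim (fun (_ : Unit) ω => Φ k ω)
      (fun (s : {l : L // inner ℝ l k = 0}) ω => Φ s ω)) P := by
    have h := hΦ.isGaussianProcess.comp_right
      (Sum.elim (fun _ : Unit => k) (fun s : {l : L // inner ℝ l k = 0} => (s : L)))
    refine h.congr ?_
    rintro (x | x) <;> rfl
  have h := hproc.indepFun_of_covariance_eq_zero (fun _ => (hm _).aemeasurable)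
    (fun _ => (hm _).aemeasurable) fun _ s => by
      rw [covariance_eq_sub
        ((hΦ.isGaussianProcess.hasGaussianLaw_eval k).memLp_two)
        ((hΦ.isGaussianProcess.hasGaussianLaw_eval (s : L)).memLp_two)]
      have := hΦ.covariance k s
      rw [real_inner_comm, s.2] at this
      simp only [Pi.mul_apply]
      rw [this, hΦ.mean_zero k]
      simp
  exact h.comp (φ := fun f : Unit → ℝ => f ()) (ψ := id) (measurable_pi_apply _) measurable_id

theorem polyEval_rename_eq_eval {σ : Type*} (f : σ → L) (b : MvPolynomial σ ℝ) (ω : Ω) :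
    polyEval Φ (MvPolynomial.rename f b) ω = MvPolynomial.eval (fun s => Φ (f s) ω) b :=
  MvPolynomial.eval_rename ..

theorem measurable_eval_mvPolynomial {σ : Type*} (b : MvPolynomial σ ℝ) :
    Measurable fun x : σ → ℝ => MvPolynomial.eval x b := by
  induction b using MvPolynomial.induction_on with
  | C a => simp
  | add p q hp hq => simp only [map_add]; exact hp.add hq
  | mul_X p l hp => simp only [map_mul, MvPolynomial.eval_X]; exact hp.mul (measurable_pi_apply l)

theorem IsGaussianField.integral_pow_mul_rename (hΦ : IsGaussianField Φ) {k : L} (n : ℕ)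
    (b : MvPolynomial {l : L // inner ℝ l k = 0} ℝ) :
    ∫ ω, Φ k ω ^ n * polyEval Φ (MvPolynomial.rename Subtype.val b) ω ∂P =
      (∫ ω, Φ k ω ^ n ∂P) * ∫ ω, polyEval Φ (MvPolynomial.rename Subtype.val b) ω ∂P := by
  have hm : ∀ l, Measurable fun ω => Φ l ω := fun l => (Lp.stronglyMeasurable _).measurable
  simp only [polyEval_rename_eq_eval]
  have h := (hΦ.indepFun_orthogonal k).comp (φ := fun x => x ^ n)
    (ψ := fun x => MvPolynomial.eval x b) (by fun_prop) (measurable_eval_mvPolynomial b)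
  exact h.integral_fun_mul_eq_mul_integral ((hm k).pow_const n).aestronglyMeasurable
    ((measurable_eval_mvPolynomial b).comp (measurable_pi_lambda _ fun s => hm s)).aestronglyMeasurable

theorem IsGaussianField.integral_mul_pow (hΦ : IsGaussianField Φ) {k : L} (hk : ‖k‖ = 1) (n : ℕ) :
    ∫ ω, Φ k ω * Φ k ω ^ n ∂P = n * ∫ ω, Φ k ω ^ (n - 1) ∂P := by
  have hm : Measurable fun ω => Φ k ω := (Lp.stronglyMeasurable _).measurable
  have h := hΦ.map_eq_gaussianReal k
  rw [hk, one_pow, Real.toNNReal_one] at h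
  have h1 := integral_mul_pow_gaussianReal n
  rw [← h, integral_map hm.aemeasurable (by fun_prop),
    integral_map hm.aemeasurable (by fun_prop)] at h1
  exact h1

theorem field_add_ae (h k : L) : ∀ᵐ ω ∂P, Φ (h + k) ω = Φ h ω + Φ k ω := by
  rw [map_add]
  exact Lp.coeFn_add _ _

theorem field_smul_ae (c : ℝ) (h : L) : ∀ᵐ ω ∂P, Φ (c • h) ω = c * Φ h ω := by
  rw [map_smul]
  exact Lp.coeFn_smul _ _

/-- Integration by parts in a direction of norm one. -/
theorem IsGaussianField.integral_mul_polyEval_of_norm_eq_one (hΦ : IsGaussianField Φ) {k : L}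
    (hk : ‖k‖ = 1) (p : MvPolynomial L ℝ) :
    ∫ ω, Φ k ω * polyEval Φ p ω ∂P = ∫ ω, polyEval Φ (dirDeriv k p) ω ∂P := by
  set σ := {l : L // inner ℝ l k = 0} with hσ
  have hkk : inner ℝ k k = (1 : ℝ) := by rw [real_inner_self_eq_norm_sq, hk, one_pow]
  have hperp : ∀ l : L, inner ℝ (l - (inner ℝ l k : ℝ) • k) k = (0 : ℝ) := fun l => by
    rw [inner_sub_left, real_inner_smul_left, hkk, mul_one, sub_self]
  -- Each variable `l` is split along `k` and `k^⊥`. This yields a polynomial in one variable,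
  -- standing for `Φ(k)`, whose coefficients involve only `k^⊥` and so are independent of `Φ(k)`.
  -- The map `η` substitutes back.
  let θ : MvPolynomial L ℝ →ₐ[ℝ] Polynomial (MvPolynomial σ ℝ) := MvPolynomial.aeval fun l =>
    Polynomial.C (MvPolynomial.X ⟨_, hperp l⟩) +
      Polynomial.C (MvPolynomial.C (inner ℝ l k : ℝ)) * Polynomial.X
  let η : Polynomial (MvPolynomial σ ℝ) →+* MvPolynomial L ℝ := Polynomial.eval₂RingHom
    (MvPolynomial.rename (Subtype.val : σ → L)).toRingHom (MvPolynomial.X k)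
  have hθC : ∀ a : ℝ, θ (MvPolynomial.C a) = Polynomial.C (MvPolynomial.C a) := fun a =>
    MvPolynomial.aeval_C _ a
  have hθX : ∀ l, θ (MvPolynomial.X l) = Polynomial.C (MvPolynomial.X ⟨_, hperp l⟩) +
      Polynomial.C (MvPolynomial.C (inner ℝ l k : ℝ)) * Polynomial.X := fun l =>
    MvPolynomial.aeval_X _ l
  -- `η ∘ θ` is not the identity on polynomials; the two evaluations agree only almost surely, by
  -- linearity of `Φ`.
  have hηθ : ∀ p, polyEval Φ p =ᵐ[P] polyEval Φ (η (θ p)) := fun p => by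
    induction p using MvPolynomial.induction_on with
    | C a => simp [hθC, η]
    | add p q hp hq =>
      rw [map_add, map_add, polyEval_add, polyEval_add]
      exact hp.add hq
    | mul_X p l hp =>
      rw [map_mul, map_mul, polyEval_mul, polyEval_mul]
      refine hp.mul ?_
      have h1 : η (θ (MvPolynomial.X l)) = MvPolynomial.X (l - (inner ℝ l k : ℝ) • k) +
          MvPolynomial.C (inner ℝ l k : ℝ) * MvPolynomial.X k := by
        simp [hθX, η]
      rw [h1]
      filter_upwards [field_add_ae (Φ := Φ) (l - (inner ℝ l k : ℝ) • k) ((inner ℝ l k : ℝ) • k),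
        field_smul_ae (Φ := Φ) (inner ℝ l k : ℝ) k] with ω h2 h3
      rw [sub_add_cancel] at h2
      simp only [polyEval, MvPolynomial.eval_X, map_add, map_mul, MvPolynomial.eval_C, h2, h3]
  have hder : ∀ p, θ (dirDeriv k p) = Polynomial.derivative (θ p) := fun p => by
    induction p using MvPolynomial.induction_on with
    | C a => simp [hθC]
    | add p q hp hq => simp [hp, hq]
    | mul_X p l hp =>
      rw [Derivation.leibniz, dirDeriv_X, smul_eq_mul, smul_eq_mul, map_add, map_mul, map_mul, hp,
        map_mul, Polynomial.derivative_mul, hθC, hθX]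
      simp
      ring
  have hmain : ∀ r, ∫ ω, Φ k ω * polyEval Φ (η r) ω ∂P =
      ∫ ω, polyEval Φ (η (Polynomial.derivative r)) ω ∂P := fun r => by
    have hX : ∀ r, (fun ω => Φ k ω * polyEval Φ (η r) ω) =
        polyEval Φ (MvPolynomial.X k * η r) := fun r => by
      rw [polyEval_mul, polyEval_X]
      rfl
    induction r using Polynomial.induction_on' with
    | add r s hr hs =>
      simp only [hX] at hr hs ⊢
      rw [map_add, map_add, mul_add, map_add, polyEval_add, polyEval_add,
        integral_add' (hΦ.integrable_polyEval _) (hΦ.integrable_polyEval _),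
        integral_add' (hΦ.integrable_polyEval _) (hΦ.integrable_polyEval _), hr, hs]
    | monomial n b =>
      have hη : ∀ n b ω, polyEval Φ (η (Polynomial.monomial n b)) ω =
          Φ k ω ^ n * polyEval Φ (MvPolynomial.rename Subtype.val b) ω := fun n b ω => by
        simp [η, polyEval, Polynomial.eval₂_monomial, mul_comm]
      rw [Polynomial.derivative_monomial]
      have hn : (n : MvPolynomial σ ℝ) = MvPolynomial.C (n : ℝ) := by simp
      simp only [hη, hn, map_mul, MvPolynomial.rename_C, polyEval_mul, polyEval_C, Pi.mul_apply]
      -- Independence splits off the power of `Φ(k)`, the one-dimensional formula lowers its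
      -- exponent, and independence recombines the factors.
      have e1 := hΦ.integral_pow_mul_rename (n + 1) b
      have e2 := hΦ.integral_pow_mul_rename (n - 1) b
      have e3 := hΦ.integral_mul_pow hk n
      simp only [← mul_assoc, ← pow_succ'] at e3 ⊢
      rw [e1, e3, mul_assoc, ← e2, ← integral_const_mul]
      congr 1
      ext ω
      ring
  rw [integral_congr_ae ((hηθ (dirDeriv k p)).trans (by rw [hder])), ← hmain]
  refine integral_congr_ae ?_
  filter_upwards [hηθ p] with ω h
  rw [h]

/-- Gaussian integration by parts. -/
theorem IsGaussianField.integral_mul_polyEval (hΦ : IsGaussianField Φ) (k : L)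
    (p : MvPolynomial L ℝ) :
    ∫ ω, Φ k ω * polyEval Φ p ω ∂P = ∫ ω, polyEval Φ (dirDeriv k p) ω ∂P := by
  obtain ⟨u, c, hu, rfl⟩ : ∃ (u : L) (c : ℝ), (‖u‖ = 1 ∨ c = 0) ∧ k = c • u := by
    rcases eq_or_ne k 0 with rfl | hk
    · exact ⟨0, 0, by simp⟩
    · exact ⟨‖k‖⁻¹ • k, ‖k‖, Or.inl (norm_smul_inv_norm hk), by
        rw [smul_smul, mul_inv_cancel₀ (norm_ne_zero_iff.2 hk), one_smul]⟩
  have h1 : ∫ ω, Φ (c • u) ω * polyEval Φ p ω ∂P = c * ∫ ω, Φ u ω * polyEval Φ p ω ∂P := by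
    rw [← integral_const_mul]
    refine integral_congr_ae ?_
    filter_upwards [field_smul_ae (Φ := Φ) c u] with ω h
    rw [h, mul_assoc]
  have h2 : ∫ ω, polyEval Φ (dirDeriv (c • u) p) ω ∂P =
      c * ∫ ω, polyEval Φ (dirDeriv u p) ω ∂P := by
    rw [dirDeriv_smul, polyEval_smul, ← integral_const_mul]
    rfl
  rw [h1, h2]
  rcases hu with hu | rfl
  · rw [hΦ.integral_mul_polyEval_of_norm_eq_one hu]
  · simp

/-- Integration by parts applied to `p * g`, with the product rule: this identifies `divergence k`
as the formal adjoint of `dirDeriv k`. -/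
theorem IsGaussianField.integral_dirDeriv_mul (hΦ : IsGaussianField Φ) (k : L)
    (p g : MvPolynomial L ℝ) :
    ∫ ω, polyEval Φ (dirDeriv k p * g) ω ∂P = ∫ ω, polyEval Φ (p * divergence k g) ω ∂P := by
  have h := hΦ.integral_mul_polyEval k (p * g)
  have e1 : dirDeriv k (p * g) = p * dirDeriv k g + dirDeriv k p * g := by
    rw [Derivation.leibniz, smul_eq_mul, smul_eq_mul, mul_comm g]
  have e2 : (fun ω => Φ k ω * polyEval Φ (p * g) ω) =
      polyEval Φ (p * (MvPolynomial.X k * g)) := by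
    ext ω
    simp [polyEval]
    ring
  rw [e1, e2, polyEval_add, integral_add' (hΦ.integrable_polyEval _) (hΦ.integrable_polyEval _)] at h
  rw [divergence, mul_sub, polyEval_sub,
    integral_sub' (hΦ.integrable_polyEval _) (hΦ.integrable_polyEval _), h]
  ring

end PolynomialFunctionals

/-! ### Totality of polynomial functionals in `L²` -/

section Totality

variable {L : Type*} [NormedAddCommGroup L] [InnerProductSpace ℝ L]
  {Ω : Type*} [MeasurableSpace Ω] {P : Measure Ω} {Φ : L →ₗ[ℝ] Lp ℝ 2 P}

theorem measurable_field (h : L) : Measurable fun ω => Φ h ω := (Lp.stronglyMeasurable _).measurable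

theorem field_sum_ae {ι : Type*} (s : Finset ι) (c : ι → ℝ) (h : ι → L) :
    ∀ᵐ ω ∂P, Φ (∑ i ∈ s, c i • h i) ω = ∑ i ∈ s, c i * Φ (h i) ω := by
  classical
  induction s using Finset.induction_on with
  | empty =>
    simp only [Finset.sum_empty, map_zero]
    exact Lp.coeFn_zero _ _ _
  | insert a s ha ih =>
    filter_upwards [ih, field_add_ae (Φ := Φ) (c a • h a) (∑ i ∈ s, c i • h i),
      field_smul_ae (Φ := Φ) (c a) (h a)] with ω h1 h2 h3
    rw [Finset.sum_insert ha, Finset.sum_insert ha, h2, h3, h1]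

theorem IsGaussianField.integrable_exp_mul (hΦ : IsGaussianField Φ) (h : L) (t : ℝ) :
    Integrable (fun ω => Real.exp (t * Φ h ω)) P := by
  have h1 := integrable_exp_mul_gaussianReal (μ := 0) (v := (‖h‖ ^ 2).toNNReal) t
  rw [← hΦ.map_eq_gaussianReal h] at h1
  exact (integrable_map_measure (by fun_prop) (measurable_field h).aemeasurable).1 h1

theorem IsGaussianField.memLp_exp_abs (hΦ : IsGaussianField Φ) (h : L) :
    MemLp (fun ω => Real.exp |Φ h ω|) 2 P := by
  have hm : Measurable fun ω => Real.exp |Φ h ω| := (measurable_field h).abs.exp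
  rw [memLp_two_iff_integrable_sq hm.aestronglyMeasurable]
  have := integrable_exp_mul_abs (X := fun ω => Φ h ω) (t := 2) (hΦ.integrable_exp_mul h 2)
    (hΦ.integrable_exp_mul h (-2))
  refine this.congr (Filter.Eventually.of_forall fun ω => ?_)
  dsimp only
  rw [← Real.exp_nat_mul]
  norm_num

/-- The exponential series is integrated termwise. Its terms are dominated by those of `|X| exp
|Φ(h)|`, which is integrable as a product of two `L²` functions. -/
theorem IsGaussianField.integral_mul_cexp_eq_zero (hΦ : IsGaussianField Φ) {X : Ω → ℝ}
    (hX : MemLp X 2 P) (h0 : ∀ p, ∫ ω, X ω * polyEval Φ p ω ∂P = 0) (h : L) :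
    ∫ ω, (X ω : ℂ) * Complex.exp (Φ h ω * Complex.I) ∂P = 0 := by
  have hsum : HasSum
      (fun n : ℕ => ∫ ω, (X ω : ℂ) * ((Φ h ω * Complex.I) ^ n / n.factorial) ∂P)
      (∫ ω, (X ω : ℂ) * Complex.exp (Φ h ω * Complex.I) ∂P) := by
    refine hasSum_integral_of_dominated_convergence
      (fun n ω => |X ω| * (|Φ h ω| ^ n / n.factorial)) (fun n => ?_) (fun n => ?_) ?_ ?_ ?_
    · refine (Complex.measurable_ofReal.comp_aemeasurable hX.1.aemeasurable).mul
        ?_ |>.aestronglyMeasurable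
      have := measurable_field (Φ := Φ) h
      fun_prop
    · exact Filter.Eventually.of_forall fun ω => by simp
    · exact Filter.Eventually.of_forall fun ω =>
        (Real.summable_pow_div_factorial _).mul_left _
    · have hi : Integrable (fun ω => |X ω| * Real.exp |Φ h ω|) P :=
        MemLp.integrable_mul (p := 2) (q := 2) hX.abs (hΦ.memLp_exp_abs h)
      have hs : ∀ y : ℝ, HasSum (fun n : ℕ => y ^ n / n.factorial) (Real.exp y) := fun y => by
        rw [Real.exp_eq_exp_ℝ]
        exact NormedSpace.expSeries_div_hasSum_exp y
      convert hi using 2 with ω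
      exact ((hs |Φ h ω|).mul_left |X ω|).tsum_eq
    · refine Filter.Eventually.of_forall fun ω => ?_
      have hs : ∀ y : ℂ, HasSum (fun n : ℕ => y ^ n / n.factorial) (Complex.exp y) := fun y => by
        rw [Complex.exp_eq_exp_ℂ]
        exact NormedSpace.expSeries_div_hasSum_exp y
      exact (hs (Φ h ω * Complex.I)).mul_left (X ω : ℂ)
  refine hsum.unique ?_
  convert hasSum_zero using 1
  ext n
  have h1 := h0 (MvPolynomial.X h ^ n)
  have h2 : ∀ ω, (X ω : ℂ) * ((Φ h ω * Complex.I) ^ n / n.factorial) =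
      (Complex.I ^ n / n.factorial) *
        ((X ω * polyEval Φ (MvPolynomial.X h ^ n) ω : ℝ) : ℂ) := fun ω => by
    simp only [polyEval, map_pow, MvPolynomial.eval_X]
    push_cast
    ring
  simp only [h2]
  rw [integral_const_mul, integral_complex_ofReal, h1]
  simp

theorem integral_withDensity_pos_eq_neg {X : Ω → ℝ} (hXm : Measurable X) (hX : Integrable X P)
    {f : Ω → ℂ} (hf : Measurable f) (hf1 : ∀ ω, ‖f ω‖ ≤ 1)
    (h0 : ∫ ω, (X ω : ℂ) * f ω ∂P = 0) :
    ∫ ω, f ω ∂(P.withDensity fun ω => ENNReal.ofReal (X ω)) =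
      ∫ ω, f ω ∂(P.withDensity fun ω => ENNReal.ofReal (-X ω)) := by
  have hint : ∀ Y : Ω → ℝ, Measurable Y → Integrable Y P →
      Integrable (fun ω => (ENNReal.ofReal (Y ω)).toReal • f ω) P := fun Y hYm hY => by
    refine hY.mono (by fun_prop) (Filter.Eventually.of_forall fun ω => ?_)
    rw [norm_smul, ENNReal.toReal_ofReal', Real.norm_eq_abs, Real.norm_eq_abs]
    refine (mul_le_mul_of_nonneg_left (hf1 ω) (abs_nonneg _)).trans ?_
    rw [mul_one, abs_of_nonneg (le_max_right _ _)]
    exact max_le (le_abs_self _) (abs_nonneg _)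
  rw [integral_withDensity_eq_integral_toReal_smul (by fun_prop)
      (Filter.Eventually.of_forall fun _ => ENNReal.ofReal_lt_top),
    integral_withDensity_eq_integral_toReal_smul (by fun_prop)
      (Filter.Eventually.of_forall fun _ => ENNReal.ofReal_lt_top), ← sub_eq_zero,
    ← integral_sub (hint X hXm hX) (hint (fun ω => -X ω) hXm.neg hX.neg), ← h0]
  refine integral_congr_ae (Filter.Eventually.of_forall fun ω => ?_)
  dsimp only
  rw [← sub_smul, ENNReal.toReal_ofReal', ENNReal.toReal_ofReal', Complex.real_smul]
  congr 2
  rcases le_total 0 (X ω) with h | h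
  · rw [max_eq_left h, max_eq_right (by linarith), sub_zero]
  · rw [max_eq_right h, max_eq_left (by linarith), zero_sub, neg_neg]

/-- Cramér–Wold: since `Φ` is linear almost surely, a linear combination of field values is again
one field value, so the hypothesis gives all finite-dimensional characteristic functions.
Finite-dimensional marginals determine a finite measure on the product. -/
theorem map_field_eq_of_integral_cexp_eq {μ ν : Measure Ω} [IsFiniteMeasure μ] [IsFiniteMeasure ν]
    (hμ : μ ≪ P) (hν : ν ≪ P)
    (h : ∀ k : L, ∫ ω, Complex.exp (Φ k ω * Complex.I) ∂μ =
      ∫ ω, Complex.exp (Φ k ω * Complex.I) ∂ν) :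
    μ.map (fun ω (l : L) => Φ l ω) = ν.map (fun ω (l : L) => Φ l ω) := by
  have hm : Measurable fun ω (l : L) => Φ l ω := measurable_pi_lambda _ measurable_field
  classical
  have hlim : IsProjectiveLimit (μ.map fun ω (l : L) => Φ l ω)
      fun I => (ν.map fun ω (l : L) => Φ l ω).map I.restrict := fun I => by
    have hr : Measurable (I.restrict (π := fun _ : L => ℝ)) := Finset.measurable_restrict I
    dsimp only
    rw [Measure.map_map hr hm, Measure.map_map hr hm]
    refine Measure.ext_of_charFunDual ?_
    ext ℓ
    have key : ∀ ρ : Measure Ω, ρ ≪ P →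
        charFunDual (ρ.map (I.restrict ∘ fun ω (l : L) => Φ l ω)) ℓ =
        ∫ ω, Complex.exp (Φ (∑ i : I, ℓ (Pi.single i 1) • (i : L)) ω * Complex.I) ∂ρ :=
      fun ρ hρ => by
        rw [charFunDual_apply, integral_map (hr.comp hm).aemeasurable (by fun_prop)]
        refine integral_congr_ae ?_
        filter_upwards [hρ.ae_le (field_sum_ae (Φ := Φ) Finset.univ
          (fun i : I => ℓ (Pi.single i 1)) fun i => (i : L))] with ω hω
        rw [hω]
        congr 3
        conv_lhs => rw [pi_eq_sum_univ' ((I.restrict ∘ fun ω (l : L) => Φ l ω) ω)]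
        rw [map_sum]
        refine Finset.sum_congr rfl fun i _ => ?_
        rw [map_smul, smul_eq_mul, mul_comm]
        rfl
    rw [key μ hμ, key ν hν, h]
  exact hlim.unique fun I => rfl

/-- The measures `X⁺ P` and `X⁻ P` give the field the same distribution, so they agree on the events
it generates, hence on all events up to null sets. Thus `X⁺ = X⁻` almost surely, which forces `X =
0`. -/
theorem IsGaussianField.eq_zero_of_forall_integral_mul_polyEval (hΦ : IsGaussianField Φ)
    (hgen : GeneratesEvents Φ) (X : Lp ℝ 2 P)
    (h0 : ∀ p, ∫ ω, X ω * polyEval Φ p ω ∂P = 0) : X = 0 := by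
  have := hΦ.isGaussianProcess.isProbabilityMeasure
  have hXm : Measurable X := (Lp.stronglyMeasurable X).measurable
  have hXi : Integrable X P := (Lp.memLp X).integrable (by norm_num)
  have := isFiniteMeasure_withDensity_ofReal hXi.2
  have := isFiniteMeasure_withDensity_ofReal hXi.neg.2
  have hmap := map_field_eq_of_integral_cexp_eq (Φ := Φ)
    (withDensity_absolutelyContinuous P fun ω => ENNReal.ofReal (X ω))
    (withDensity_absolutelyContinuous P fun ω => ENNReal.ofReal (-X ω)) fun k => by
      have := measurable_field (Φ := Φ) k
      refine integral_withDensity_pos_eq_neg hXm hXi (by fun_prop) (fun ω => ?_)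
        (hΦ.integral_mul_cexp_eq_zero (Lp.memLp X) h0 k)
      rw [Complex.norm_exp_ofReal_mul_I]
  have hm : Measurable fun ω (l : L) => Φ l ω := measurable_pi_lambda _ measurable_field
  have heq : (P.withDensity fun ω => ENNReal.ofReal (X ω)) =
      P.withDensity fun ω => ENNReal.ofReal (-X ω) := by
    ext A hA
    obtain ⟨B, hB, hAB⟩ := hgen A hA
    have hB' : ∃ S, MeasurableSet S ∧ (fun ω (l : L) => Φ l ω) ⁻¹' S = B := by
      have : (⨆ h : L, MeasurableSpace.comap (fun ω => Φ h ω) (borel ℝ)) =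
          MeasurableSpace.comap (fun ω (l : L) => Φ l ω) MeasurableSpace.pi := by
        simp only [MeasurableSpace.pi, MeasurableSpace.comap_iSup, MeasurableSpace.comap_comp]
        rfl
      rw [this] at hB
      exact hB
    obtain ⟨S, hS, rfl⟩ := hB'
    rw [measure_congr ((withDensity_absolutelyContinuous P _).ae_eq hAB),
      measure_congr ((withDensity_absolutelyContinuous P _).ae_eq hAB),
      ← Measure.map_apply hm hS, ← Measure.map_apply hm hS, hmap]
  rw [withDensity_eq_iff_of_sigmaFinite (by fun_prop) (by fun_prop)] at heq
  refine Lp.ext ?_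
  filter_upwards [heq, Lp.coeFn_zero ℝ 2 P] with ω h1 h2
  rw [h2, Pi.zero_apply]
  rcases le_total 0 (X ω) with h | h
  · rw [ENNReal.ofReal_of_nonpos (by linarith : -X ω ≤ 0), ENNReal.ofReal_eq_zero] at h1
    exact le_antisymm h1 h
  · rw [ENNReal.ofReal_of_nonpos h, eq_comm, ENNReal.ofReal_eq_zero] at h1
    linarith

end Totality

/-! ### The Malliavin derivative and its adjoint -/

section MalliavinDerivative

variable {L : Type*} [NormedAddCommGroup L] [InnerProductSpace ℝ L]
  {Ω : Type*} [MeasurableSpace Ω] {P : Measure Ω} {Φ : L →ₗ[ℝ] Lp ℝ 2 P}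

/-- Polynomial functionals of a Gaussian field as elements of `L²`. -/
def polyLp (hΦ : IsGaussianField Φ) : MvPolynomial L ℝ →ₗ[ℝ] Lp ℝ 2 P where
  toFun p := (hΦ.memLp_polyEval p ENNReal.ofNat_ne_top).toLp _
  map_add' p q := by
    rw [← MemLp.toLp_add]
    exact MemLp.toLp_congr _ _ (by rw [polyEval_add])
  map_smul' c p := by
    rw [RingHom.id_apply, ← MemLp.toLp_const_smul]
    exact MemLp.toLp_congr _ _ (by rw [polyEval_smul])

theorem coeFn_polyLp (hΦ : IsGaussianField Φ) (p : MvPolynomial L ℝ) :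
    polyLp hΦ p =ᵐ[P] polyEval Φ p :=
  MemLp.coeFn_toLp (hΦ.memLp_polyEval p ENNReal.ofNat_ne_top)

/-- The elementary tensor `F ⊗ k`, as the random variable `F • k`. -/
def tensorLp (P : Measure Ω) (k : L) : Lp ℝ 2 P →L[ℝ] Lp L 2 P :=
  (ContinuousLinearMap.toSpanSingleton ℝ k).compLpL 2 P

theorem coeFn_tensorLp (k : L) (F : Lp ℝ 2 P) : ∀ᵐ ω ∂P, tensorLp P k F ω = F ω • k := by
  filter_upwards [(ContinuousLinearMap.toSpanSingleton ℝ k).coeFn_compLpL (p := 2) (μ := P) F]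
    with ω h
  rw [tensorLp, h, ContinuousLinearMap.toSpanSingleton_apply]

theorem inner_polyLp_polyLp (hΦ : IsGaussianField Φ) (p q : MvPolynomial L ℝ) :
    inner ℝ (polyLp hΦ p) (polyLp hΦ q) = ∫ ω, polyEval Φ (p * q) ω ∂P := by
  rw [L2.inner_def]
  refine integral_congr_ae ?_
  filter_upwards [coeFn_polyLp hΦ p, coeFn_polyLp hΦ q] with ω h1 h2
  rw [h1, h2, polyEval_mul, Pi.mul_apply, mul_comm]
  rfl

theorem inner_polyLp_left (hΦ : IsGaussianField Φ) (p : MvPolynomial L ℝ) (F : Lp ℝ 2 P) :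
    inner ℝ (polyLp hΦ p) F = ∫ ω, F ω * polyEval Φ p ω ∂P := by
  rw [L2.inner_def]
  refine integral_congr_ae ?_
  filter_upwards [coeFn_polyLp hΦ p] with ω h1
  rw [h1]
  rfl

theorem inner_tensorLp_left (k : L) (F : Lp ℝ 2 P) (ψ : Lp L 2 P) :
    inner ℝ (tensorLp P k F) ψ = ∫ ω, inner ℝ (ψ ω) k * F ω ∂P := by
  rw [L2.inner_def]
  refine integral_congr_ae ?_
  filter_upwards [coeFn_tensorLp k F] with ω h1
  rw [h1, real_inner_smul_left, real_inner_comm, mul_comm]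

theorem dirDeriv_rename {ι : Type*} [Fintype ι] (h : ι → L) (k : L) (p : MvPolynomial ι ℝ) :
    dirDeriv k (MvPolynomial.rename h p) =
      ∑ j, MvPolynomial.C (inner ℝ (h j) k) *
        MvPolynomial.rename h (MvPolynomial.pderiv j p) := by
  classical
  induction p using MvPolynomial.induction_on with
  | C a => simp
  | add p q hp hq => simp [hp, hq, mul_add, Finset.sum_add_distrib]
  | mul_X p i hp =>
    rw [map_mul, MvPolynomial.rename_X, Derivation.leibniz, dirDeriv_X, hp, smul_eq_mul,
      smul_eq_mul, Finset.mul_sum]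
    simp only [Derivation.leibniz, smul_eq_mul, map_add, map_mul, mul_add,
      Finset.sum_add_distrib, MvPolynomial.pderiv_X, MvPolynomial.rename_X]
    congr 1
    · rw [Finset.sum_eq_single i]
      · simp
        ring
      · intro j _ hj
        simp [Pi.single_eq_of_ne' hj]
      · simp
    · exact Finset.sum_congr rfl fun j _ => by ring

/-- The exceptional null set depends on `k` and `L` may be nonseparable; the separable range of `ψ`
is what permits a single null set. -/
theorem eq_zero_of_forall_inner_ae_eq_zero [CompleteSpace L] (ψ : Lp L 2 P)
    (h : ∀ k : L, ∀ᵐ ω ∂P, inner ℝ (ψ ω) k = (0 : ℝ)) : ψ = 0 := by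
  refine Lp.ext ?_
  refine Filter.EventuallyEq.trans ?_ (Lp.coeFn_zero L 2 P).symm
  refine ae_eq_zero_of_forall_dual_of_isSeparable ℝ
    (Lp.stronglyMeasurable ψ).isSeparable_range (fun c => ?_)
    (Filter.Eventually.of_forall fun ω => Set.mem_range_self ω)
  filter_upwards [h ((InnerProductSpace.toDual ℝ L).symm c)] with ω hω
  rw [real_inner_comm, InnerProductSpace.toDual_symm_apply] at hω
  exact hω

/-- Normal form for the span: with variables indexed by all of `L`, functionals of different finite
families add as polynomials, and the gradient is recorded by its components `⟪TF, k⟫ = ∂ₖp`. -/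
theorem exists_poly_of_mem_malliavinGraph {F : Lp ℝ 2 P} {ψ : Lp L 2 P}
    (hx : (F, ψ) ∈ malliavinGraph Φ) : ∃ p : MvPolynomial L ℝ, F =ᵐ[P] polyEval Φ p ∧
      ∀ k : L, ∀ᵐ ω ∂P, inner ℝ (ψ ω) k = polyEval Φ (dirDeriv k p) ω := by
  suffices ∀ x ∈ malliavinGraph Φ, ∃ p : MvPolynomial L ℝ, x.1 =ᵐ[P] polyEval Φ p ∧
      ∀ k : L, ∀ᵐ ω ∂P, inner ℝ (x.2 ω) k = polyEval Φ (dirDeriv k p) ω from this _ hx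
  intro x hx
  induction hx using Submodule.span_induction with
  | mem x hx =>
    obtain ⟨n, h, p, h1, h2⟩ := hx
    refine ⟨MvPolynomial.rename h p, ?_, fun k => ?_⟩
    · filter_upwards [h1] with ω hω
      rw [hω, polyEval_rename_eq_eval]
    · filter_upwards [h2] with ω hω
      rw [hω, dirDeriv_rename, polyEval_sum, Finset.sum_apply, sum_inner]
      refine Finset.sum_congr rfl fun j _ => ?_
      rw [polyEval_mul, Pi.mul_apply, polyEval_C, polyEval_rename_eq_eval, real_inner_smul_left,
        mul_comm]
  | zero =>
    refine ⟨0, ?_, fun k => ?_⟩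
    · filter_upwards [Lp.coeFn_zero ℝ 2 P] with ω hω
      rw [Prod.fst_zero, hω]
      simp [polyEval]
    · filter_upwards [Lp.coeFn_zero L 2 P] with ω hω
      rw [Prod.snd_zero, hω]
      simp [polyEval]
  | add x y _ _ hx hy =>
    obtain ⟨p, hp1, hp2⟩ := hx
    obtain ⟨q, hq1, hq2⟩ := hy
    refine ⟨p + q, ?_, fun k => ?_⟩
    · filter_upwards [hp1, hq1, Lp.coeFn_add x.1 y.1] with ω e1 e2 e3
      rw [Prod.fst_add, e3, Pi.add_apply, e1, e2, polyEval_add, Pi.add_apply]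
    · filter_upwards [hp2 k, hq2 k, Lp.coeFn_add x.2 y.2] with ω e1 e2 e3
      rw [Prod.snd_add, e3, Pi.add_apply, inner_add_left, e1, e2, map_add, polyEval_add,
        Pi.add_apply]
  | smul c x _ hx =>
    obtain ⟨p, hp1, hp2⟩ := hx
    refine ⟨c • p, ?_, fun k => ?_⟩
    · filter_upwards [hp1, Lp.coeFn_smul c x.1] with ω e1 e3
      rw [Prod.smul_fst, e3, Pi.smul_apply, e1, polyEval_smul, Pi.smul_apply]
    · filter_upwards [hp2 k, Lp.coeFn_smul c x.2] with ω e1 e3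
      rw [Prod.smul_snd, e3, Pi.smul_apply, real_inner_smul_left, e1, Derivation.map_smul,
        polyEval_smul, Pi.smul_apply, smul_eq_mul]

/-- The gradient of a polynomial functional. -/
def gradLp (hΦ : IsGaussianField Φ) {n : ℕ} (h : Fin n → L) (p : MvPolynomial (Fin n) ℝ) :
    Lp L 2 P :=
  ∑ j, tensorLp P (h j) (polyLp hΦ (MvPolynomial.rename h (MvPolynomial.pderiv j p)))

theorem isPolyField_polyLp (hΦ : IsGaussianField Φ) {n : ℕ} (h : Fin n → L)
    (p : MvPolynomial (Fin n) ℝ) : IsPolyField Φ h p (polyLp hΦ (MvPolynomial.rename h p)) := by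
  filter_upwards [coeFn_polyLp hΦ (MvPolynomial.rename h p)] with ω hω
  rw [hω, polyEval_rename_eq_eval]

theorem isPolyFieldDeriv_gradLp (hΦ : IsGaussianField Φ) {n : ℕ} (h : Fin n → L)
    (p : MvPolynomial (Fin n) ℝ) : IsPolyFieldDeriv Φ h p (gradLp hΦ h p) := by
  have h1 := Lp.coeFn_finsetSum Finset.univ fun j =>
    tensorLp P (h j) (polyLp hΦ (MvPolynomial.rename h (MvPolynomial.pderiv j p)))
  have h2 : ∀ᵐ ω ∂P, ∀ j, tensorLp P (h j)
      (polyLp hΦ (MvPolynomial.rename h (MvPolynomial.pderiv j p))) ω =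
      MvPolynomial.eval (fun i => Φ (h i) ω) (MvPolynomial.pderiv j p) • h j := by
    rw [ae_all_iff]
    intro j
    filter_upwards [coeFn_tensorLp (h j)
      (polyLp hΦ (MvPolynomial.rename h (MvPolynomial.pderiv j p))),
      coeFn_polyLp hΦ (MvPolynomial.rename h (MvPolynomial.pderiv j p))] with ω e1 e2
    rw [e1, e2, polyEval_rename_eq_eval]
  filter_upwards [h1, h2] with ω e1 e2
  rw [gradLp, e1, Finset.sum_apply]
  exact Finset.sum_congr rfl fun j _ => e2 j

theorem mem_malliavinGraph_gradLp (hΦ : IsGaussianField Φ) {n : ℕ} (h : Fin n → L)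
    (p : MvPolynomial (Fin n) ℝ) :
    (polyLp hΦ (MvPolynomial.rename h p), gradLp hΦ h p) ∈ malliavinGraph Φ :=
  Submodule.subset_span ⟨n, h, p, isPolyField_polyLp hΦ h p, isPolyFieldDeriv_gradLp hΦ h p⟩

theorem mem_malliavinGraph_iff [CompleteSpace L] (hΦ : IsGaussianField Φ) {p : MvPolynomial L ℝ}
    {ψ : Lp L 2 P} (hψ : ∀ k : L, ∀ᵐ ω ∂P, inner ℝ (ψ ω) k = polyEval Φ (dirDeriv k p) ω) :
    (polyLp hΦ p, ψ) ∈ malliavinGraph Φ := by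
  obtain ⟨n, h, -, q, rfl⟩ := p.exists_fin_rename
  convert mem_malliavinGraph_gradLp hΦ h q using 2
  rw [← sub_eq_zero]
  refine eq_zero_of_forall_inner_ae_eq_zero _ fun k => ?_
  filter_upwards [hψ k, isPolyFieldDeriv_gradLp hΦ h q, Lp.coeFn_sub ψ (gradLp hΦ h q)]
    with ω e1 e2 e3
  rw [e3, Pi.sub_apply, inner_sub_left, e1, e2, dirDeriv_rename, polyEval_sum, Finset.sum_apply,
    sum_inner, sub_eq_zero]
  refine Finset.sum_congr rfl fun j _ => ?_
  rw [polyEval_mul, Pi.mul_apply, polyEval_C, polyEval_rename_eq_eval, real_inner_smul_left,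
    mul_comm]

/-- Well-definedness of `T`: if `p(Φ) = 0` almost surely, then `E[(∂ₖp)²] = E[p δₖ∂ₖp] = 0` for
every `k`. -/
theorem snd_eq_zero_of_mem_malliavinGraph [CompleteSpace L] (hΦ : IsGaussianField Φ)
    {x : Lp ℝ 2 P × Lp L 2 P} (hx : x ∈ malliavinGraph Φ) (h0 : x.1 = 0) : x.2 = 0 := by
  obtain ⟨p, hp1, hp2⟩ := exists_poly_of_mem_malliavinGraph (F := x.1) (ψ := x.2) hx
  have hp0 : ∀ᵐ ω ∂P, polyEval Φ p ω = 0 := by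
    filter_upwards [hp1, Lp.coeFn_zero ℝ 2 P] with ω e1 e2
    rw [← e1, h0, e2, Pi.zero_apply]
  refine eq_zero_of_forall_inner_ae_eq_zero _ fun k => ?_
  have h1 := hΦ.integral_dirDeriv_mul k p (dirDeriv k p)
  have h2 : ∫ ω, polyEval Φ (p * divergence k (dirDeriv k p)) ω ∂P = 0 := by
    refine integral_eq_zero_of_ae ?_
    filter_upwards [hp0] with ω e
    rw [polyEval_mul, Pi.mul_apply, e, zero_mul, Pi.zero_apply]
  rw [h2, integral_eq_zero_iff_of_nonneg (fun ω => by
    rw [polyEval_mul]; exact mul_self_nonneg _) (hΦ.integrable_polyEval _)] at h1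
  filter_upwards [hp2 k, h1] with ω e1 e2
  rw [polyEval_mul, Pi.mul_apply, Pi.zero_apply, mul_self_eq_zero] at e2
  rw [e1, e2]

theorem graph_malliavin [CompleteSpace L] (hΦ : IsGaussianField Φ) :
    (malliavin Φ).graph = malliavinGraph Φ :=
  Submodule.toLinearPMap_graph_eq _ fun _ hx h0 => snd_eq_zero_of_mem_malliavinGraph hΦ hx h0

theorem dense_of_polyLp_mem (hΦ : IsGaussianField Φ) (hgen : GeneratesEvents Φ)
    {K : Submodule ℝ (Lp ℝ 2 P)} (hK : ∀ p, polyLp hΦ p ∈ K) : Dense (K : Set (Lp ℝ 2 P)) := by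
  rw [Submodule.dense_iff_topologicalClosure_eq_top, Submodule.topologicalClosure_eq_top_iff,
    Submodule.eq_bot_iff]
  intro F hF
  refine hΦ.eq_zero_of_forall_integral_mul_polyEval hgen F fun p => ?_
  rw [← inner_polyLp_left hΦ]
  exact hF _ (hK p)

theorem dense_domain_malliavin [CompleteSpace L] (hΦ : IsGaussianField Φ)
    (hgen : GeneratesEvents Φ) : Dense ((malliavin Φ).domain : Set (Lp ℝ 2 P)) := by
  refine dense_of_polyLp_mem hΦ hgen fun p => ?_
  obtain ⟨n, h, -, q, rfl⟩ := p.exists_fin_rename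
  have := mem_malliavinGraph_gradLp hΦ h q
  rw [← graph_malliavin hΦ] at this
  exact LinearPMap.mem_domain_of_mem_graph this

theorem tensorLp_mem_graph_adjoint [CompleteSpace L] (hΦ : IsGaussianField Φ)
    (hgen : GeneratesEvents Φ) (k : L) (g : MvPolynomial L ℝ) :
    (tensorLp P k (polyLp hΦ g), polyLp hΦ (divergence k g)) ∈ (malliavin Φ).adjoint.graph := by
  refine mem_graph_adjoint_of_forall (T := malliavin Φ) (dense_domain_malliavin hΦ hgen)
    fun F ψ hx => ?_
  rw [graph_malliavin hΦ] at hx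
  obtain ⟨p, hp1, hp2⟩ := exists_poly_of_mem_malliavinGraph hx
  rw [inner_polyLp_left, inner_tensorLp_left]
  trans ∫ ω, polyEval Φ (p * divergence k g) ω ∂P
  · refine integral_congr_ae ?_
    filter_upwards [hp1] with ω e
    rw [e, polyEval_mul, Pi.mul_apply]
  · rw [← hΦ.integral_dirDeriv_mul]
    refine integral_congr_ae ?_
    filter_upwards [hp2 k, coeFn_polyLp hΦ g] with ω e1 e2
    rw [e1, e2, polyEval_mul, Pi.mul_apply]

/-- If `ψ` is orthogonal to every `g ⊗ k` with `g` polynomial, each component `⟪ψ, k⟫` is orthogonal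
to all polynomials and vanishes by totality. -/
theorem dense_domain_adjoint_malliavin [CompleteSpace L] (hΦ : IsGaussianField Φ)
    (hgen : GeneratesEvents Φ) : Dense ((malliavin Φ).adjoint.domain : Set (Lp L 2 P)) := by
  rw [Submodule.dense_iff_topologicalClosure_eq_top, Submodule.topologicalClosure_eq_top_iff,
    Submodule.eq_bot_iff]
  intro ψ hψ
  refine eq_zero_of_forall_inner_ae_eq_zero _ fun k => ?_
  have hmem : MemLp (fun ω => inner ℝ (ψ ω) k) 2 P := (Lp.memLp ψ).inner_const k
  have h0 : hmem.toLp _ = 0 := by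
    refine hΦ.eq_zero_of_forall_integral_mul_polyEval hgen _ fun g => ?_
    have := hψ _ (LinearPMap.mem_domain_of_mem_graph (tensorLp_mem_graph_adjoint hΦ hgen k g))
    rw [inner_tensorLp_left] at this
    rw [← this]
    refine integral_congr_ae ?_
    filter_upwards [hmem.coeFn_toLp, coeFn_polyLp hΦ g] with ω e1 e2
    rw [e1, e2]
  filter_upwards [hmem.coeFn_toLp, Lp.coeFn_zero ℝ 2 P] with ω e1 e2
  rw [← e1, h0, e2, Pi.zero_apply]

theorem isClosable_malliavin [CompleteSpace L] (hΦ : IsGaussianField Φ)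
    (hgen : GeneratesEvents Φ) : (malliavin Φ).IsClosable :=
  isClosable_of_dense_adjoint (dense_domain_malliavin hΦ hgen)
    (dense_domain_adjoint_malliavin hΦ hgen)

theorem mem_graph_malliavinLaplacian [CompleteSpace L] (hΦ : IsGaussianField Φ) {F G : Lp ℝ 2 P}
    {ψ : Lp L 2 P} (h1 : (F, ψ) ∈ malliavinGraph Φ) (h2 : (ψ, G) ∈ (malliavin Φ).adjoint.graph) :
    (F, G) ∈ (malliavinLaplacian Φ).graph := by
  rw [← graph_malliavin hΦ] at h1
  exact (mem_graph_opComp_iff _ _ _ _).2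
    ⟨ψ, LinearPMap.le_graph_of_le (malliavin Φ).le_closure h1, h2⟩

end MalliavinDerivative

/-! ### Euler's identity and Hermite polynomials -/

section ChaosPolynomials

variable {L : Type*} [NormedAddCommGroup L] [InnerProductSpace ℝ L]
  {Ω : Type*} [MeasurableSpace Ω] {P : Measure Ω} {Φ : L →ₗ[ℝ] Lp ℝ 2 P}

/-- The polynomial `∑ᵢⱼ ⟪hᵢ, hⱼ⟫ ∂ᵢ∂ⱼ q`. -/
def gramLaplacian {ι : Type*} [Fintype ι] (h : ι → L) (q : MvPolynomial ι ℝ) : MvPolynomial ι ℝ :=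
  ∑ j, ∑ i, MvPolynomial.C (inner ℝ (h i) (h j)) *
    MvPolynomial.pderiv i (MvPolynomial.pderiv j q)

/-- The terms `xⱼ ∂ⱼq` sum to `d q` by Euler's identity; the derivative part of the divergence is
the second-order remainder. -/
theorem sum_divergence_rename_pderiv {ι : Type*} [Fintype ι] (h : ι → L) {q : MvPolynomial ι ℝ}
    {d : ℕ} (hq : q.IsHomogeneous d) :
    ∑ j, divergence (h j) (MvPolynomial.rename h (MvPolynomial.pderiv j q)) =
      MvPolynomial.rename h ((d : ℝ) • q - gramLaplacian h q) := by
  have h1 := hq.sum_X_mul_pderiv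
  simp only [divergence, Finset.sum_sub_distrib, dirDeriv_rename]
  rw [map_sub]
  congr 1
  · rw [Nat.cast_smul_eq_nsmul, ← h1, map_sum]
    simp
  · simp [gramLaplacian, map_sum]

theorem isHomogeneous_gramLaplacian {ι : Type*} [Fintype ι] (h : ι → L) {q : MvPolynomial ι ℝ}
    {d : ℕ} (hq : q.IsHomogeneous d) : (gramLaplacian h q).IsHomogeneous (d - 1 - 1) :=
  MvPolynomial.IsHomogeneous.sum _ _ _ fun j _ => MvPolynomial.IsHomogeneous.sum _ _ _ fun i _ => by
    have := (MvPolynomial.isHomogeneous_C ι (inner ℝ (h i) (h j) : ℝ)).mul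
      ((hq.pderiv (i := j)).pderiv (i := i))
    rwa [zero_add] at this

/-- The Hermite polynomials in the variable `h`. -/
def hermiteField (h : L) : ℕ → MvPolynomial L ℝ
  | 0 => 1
  | n + 1 => divergence h (hermiteField h n)

/-- The analogue of `H'ₙ₊₁ = (n + 1) Hₙ`; each further application of `δₕ` contributes one more `⟪h,
k⟫`, from the derivative of the variable `h`. -/
theorem dirDeriv_hermiteField_succ (h k : L) (n : ℕ) :
    dirDeriv k (hermiteField h (n + 1)) =
      ((n + 1 : ℝ) * inner ℝ h k) • hermiteField h n := by
  induction n with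
  | zero => simp [hermiteField, divergence, MvPolynomial.smul_eq_C_mul]
  | succ n ih =>
    rw [hermiteField, divergence, map_sub, dirDeriv_comm, Derivation.leibniz, dirDeriv_X, ih,
      Derivation.map_smul]
    have : hermiteField h (n + 1) = MvPolynomial.X h * hermiteField h n -
      dirDeriv h (hermiteField h n) := rfl
    simp only [smul_eq_mul, MvPolynomial.smul_eq_C_mul]
    rw [this]
    simp only [Nat.cast_succ, map_add, map_mul, map_one, map_natCast]
    ring

/-- Integration by parts gives `E[Hₙ₊₁²] = (n + 1) E[Hₙ²]`. -/
theorem integral_hermiteField_sq_pos (hΦ : IsGaussianField Φ) {h : L} (hh : ‖h‖ = 1) (n : ℕ) :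
    0 < ∫ ω, polyEval Φ (hermiteField h n * hermiteField h n) ω ∂P := by
  have := hΦ.isGaussianProcess.isProbabilityMeasure
  induction n with
  | zero => simp [hermiteField, polyEval]
  | succ n ih =>
    have h1 := hΦ.integral_dirDeriv_mul h (hermiteField h (n + 1)) (hermiteField h n)
    rw [dirDeriv_hermiteField_succ, real_inner_self_eq_norm_sq, hh, smul_mul_assoc,
      polyEval_smul] at h1
    change _ = ∫ ω, polyEval Φ (hermiteField h (n + 1) * hermiteField h (n + 1)) ω ∂P at h1
    rw [← h1]
    simp only [Pi.smul_apply, smul_eq_mul]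
    rw [integral_const_mul]
    positivity

end ChaosPolynomials

/-- `A - d` is invertible on the sum of the eigenspaces below `d`; this removes the lower-degree
remainder in the triangular argument. -/
theorem exists_mem_iSup_fin_opEigenspace_sub_eq {𝕜 E : Type*} [RCLike 𝕜] [NormedAddCommGroup E]
    [InnerProductSpace 𝕜 E] {A : E →ₗ.[𝕜] E} {d : ℕ} {r : E}
    (hr : r ∈ ⨆ k : Fin d, opEigenspace A ((k : ℕ) : 𝕜)) :
    ∃ u ∈ ⨆ k : Fin d, opEigenspace A ((k : ℕ) : 𝕜), (u, (d : 𝕜) • u + r) ∈ A.graph := by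
  induction hr using Submodule.iSup_induction' with
  | mem k r hr =>
    have hk : ((k : ℕ) : 𝕜) - d ≠ 0 := by
      rw [sub_ne_zero, Ne, Nat.cast_inj]
      exact k.2.ne
    have hu := Submodule.smul_mem _ (((k : ℕ) : 𝕜) - d)⁻¹ hr
    refine ⟨_, Submodule.mem_iSup_of_mem k hu, ?_⟩
    convert mem_opEigenspace.1 hu using 2
    nth_rewrite 2 [show r = (((k : ℕ) : 𝕜) - d) • (((k : ℕ) : 𝕜) - d)⁻¹ • r by
      rw [smul_smul, mul_inv_cancel₀ hk, one_smul]]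
    rw [← add_smul, add_sub_cancel]
  | zero => exact ⟨0, Submodule.zero_mem _, by simp⟩
  | add x y _ _ hx hy =>
    obtain ⟨u, hu, hu'⟩ := hx
    obtain ⟨v, hv, hv'⟩ := hy
    refine ⟨u + v, Submodule.add_mem _ hu hv, ?_⟩
    convert A.graph.add_mem hu' hv' using 1
    rw [Prod.mk_add_mk, smul_add, add_add_add_comm]

/-! ### Spectral decomposition of `T* T̄` on polynomials -/

section Chaos

variable {L : Type*} [NormedAddCommGroup L] [InnerProductSpace ℝ L] [CompleteSpace L]
  {Ω : Type*} [MeasurableSpace Ω] {P : Measure Ω} {Φ : L →ₗ[ℝ] Lp ℝ 2 P}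

theorem polyLp_mem_graph_malliavinLaplacian (hΦ : IsGaussianField Φ) (hgen : GeneratesEvents Φ)
    {n : ℕ} (h : Fin n → L) {q : MvPolynomial (Fin n) ℝ} {d : ℕ} (hq : q.IsHomogeneous d) :
    (polyLp hΦ (MvPolynomial.rename h q), (d : ℝ) • polyLp hΦ (MvPolynomial.rename h q) -
      polyLp hΦ (MvPolynomial.rename h (gramLaplacian h q))) ∈ (malliavinLaplacian Φ).graph := by
  refine mem_graph_malliavinLaplacian hΦ (mem_malliavinGraph_gradLp hΦ h q) ?_
  have h1 := Submodule.sum_mem (malliavin Φ).adjoint.graph (t := Finset.univ) fun j _ =>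
    tensorLp_mem_graph_adjoint hΦ hgen (h j)
      (MvPolynomial.rename h (MvPolynomial.pderiv j q))
  convert h1 using 1
  refine Prod.ext ?_ ?_
  · rw [Prod.fst_sum]
    rfl
  · rw [Prod.snd_sum, ← map_sum, sum_divergence_rename_pderiv h hq, map_sub, map_sub, map_smul,
      map_smul]

theorem polyLp_mem_iSup_of_isHomogeneous (hΦ : IsGaussianField Φ) (hgen : GeneratesEvents Φ)
    {n : ℕ} (h : Fin n → L) (d : ℕ) : ∀ q : MvPolynomial (Fin n) ℝ, q.IsHomogeneous d →
    polyLp hΦ (MvPolynomial.rename h q) ∈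
      ⨆ k : Fin (d + 1), opEigenspace (malliavinLaplacian Φ) ((k : ℕ) : ℝ) := by
  have hmono : ∀ {a b : ℕ}, a ≤ b →
      ⨆ k : Fin a, opEigenspace (malliavinLaplacian Φ) ((k : ℕ) : ℝ) ≤
      ⨆ k : Fin b, opEigenspace (malliavinLaplacian Φ) ((k : ℕ) : ℝ) := fun {a b} hab =>
    iSup_le fun k => le_iSup (fun k : Fin b => opEigenspace (malliavinLaplacian Φ) ((k : ℕ) : ℝ))
      (Fin.castLE hab k)
  induction d using Nat.strong_induction_on with
  | _ d ih =>
    intro q hq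
    have hR : polyLp hΦ (MvPolynomial.rename h (gramLaplacian h q)) ∈
        ⨆ k : Fin d, opEigenspace (malliavinLaplacian Φ) ((k : ℕ) : ℝ) := by
      -- For `d = 0` no eigenspace is available, but `q` is constant and the remainder vanishes. For
      -- `d = 1` the truncated degree `d - 1 - 1 = 0` is still below `d`.
      rcases Nat.eq_zero_or_pos d with rfl | hd
      · have : gramLaplacian h q = 0 := by
          rw [MvPolynomial.totalDegree_eq_zero_iff_eq_C.1
            ((MvPolynomial.totalDegree_zero_iff_isHomogeneous _).2 hq)]
          simp [gramLaplacian]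
        simp [this]
      · exact hmono (by omega) (ih (d - 1 - 1) (by omega) _ (isHomogeneous_gramLaplacian h hq))
    obtain ⟨u, hu, hu'⟩ := exists_mem_iSup_fin_opEigenspace_sub_eq (Submodule.neg_mem _ hR)
    have hF := polyLp_mem_graph_malliavinLaplacian hΦ hgen h hq
    -- Both the functional of `q` and `u` are sent by `N - d` to minus the remainder, so their
    -- difference is an eigenvector for `d`.
    have hV : polyLp hΦ (MvPolynomial.rename h q) - u ∈
        opEigenspace (malliavinLaplacian Φ) (d : ℝ) := by
      refine mem_opEigenspace.2 ?_
      convert Submodule.sub_mem _ hF hu' using 1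
      rw [Prod.mk_sub_mk, smul_sub]
      congr 1
      abel
    rw [← sub_add_cancel (polyLp hΦ (MvPolynomial.rename h q)) u]
    exact Submodule.add_mem _ (Submodule.mem_iSup_of_mem (Fin.last d) (by simpa using hV))
      (hmono (Nat.le_succ d) hu)

theorem dense_iSup_opEigenspace_malliavinLaplacian (hΦ : IsGaussianField Φ)
    (hgen : GeneratesEvents Φ) :
    Dense ((⨆ n : ℕ, opEigenspace (malliavinLaplacian Φ) (n : ℝ) :
      Submodule ℝ (Lp ℝ 2 P)) : Set (Lp ℝ 2 P)) := by
  refine dense_of_polyLp_mem hΦ hgen fun p => ?_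
  obtain ⟨n, h, -, q, rfl⟩ := p.exists_fin_rename
  rw [← MvPolynomial.sum_homogeneousComponent q, map_sum, map_sum]
  refine Submodule.sum_mem _ fun d _ => ?_
  have hle : ⨆ k : Fin (d + 1), opEigenspace (malliavinLaplacian Φ) ((k : ℕ) : ℝ) ≤
      ⨆ n : ℕ, opEigenspace (malliavinLaplacian Φ) (n : ℝ) := iSup_le fun k =>
    le_iSup (fun n : ℕ => opEigenspace (malliavinLaplacian Φ) (n : ℝ)) k
  exact hle (polyLp_mem_iSup_of_isHomogeneous hΦ hgen h d _
    (MvPolynomial.homogeneousComponent_isHomogeneous d q))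

theorem opEigenspace_malliavinLaplacian_ne_bot [Nontrivial L] (hΦ : IsGaussianField Φ)
    (hgen : GeneratesEvents Φ) (n : ℕ) : opEigenspace (malliavinLaplacian Φ) (n : ℝ) ≠ ⊥ := by
  obtain ⟨h, hh⟩ := exists_norm_eq L zero_le_one
  have hne : polyLp hΦ (hermiteField h n) ≠ 0 := fun h0 => by
    have h1 := integral_hermiteField_sq_pos hΦ hh n
    rw [← inner_polyLp_polyLp hΦ, h0, inner_zero_left] at h1
    exact lt_irrefl _ h1
  refine (Submodule.ne_bot_iff _).2 ⟨_, mem_opEigenspace.2 ?_, hne⟩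
  cases n with
  | zero =>
    refine mem_graph_malliavinLaplacian hΦ (ψ := 0) (mem_malliavinGraph_iff hΦ fun k => ?_) ?_
    · filter_upwards [Lp.coeFn_zero L 2 P] with ω e
      rw [e]
      simp [hermiteField, polyEval]
    · simp
  -- The gradient of `Hₙ₊₁` is `(n + 1) Hₙ ⊗ h`, and `T*` sends `Hₙ ⊗ h` back to `Hₙ₊₁`.
  | succ n =>
    have h1 := Submodule.smul_mem _ ((n : ℝ) + 1)
      (tensorLp_mem_graph_adjoint hΦ hgen h (hermiteField h n))
    rw [Prod.smul_mk] at h1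
    rw [Nat.cast_succ]
    refine mem_graph_malliavinLaplacian hΦ (mem_malliavinGraph_iff hΦ fun k => ?_) h1
    filter_upwards [Lp.coeFn_smul ((n : ℝ) + 1) (tensorLp P h (polyLp hΦ (hermiteField h n))),
      coeFn_tensorLp h (polyLp hΦ (hermiteField h n)), coeFn_polyLp hΦ (hermiteField h n)]
      with ω e1 e2 e3
    rw [e1, Pi.smul_apply, e2, e3, dirDeriv_hermiteField_succ, polyEval_smul, Pi.smul_apply,
      real_inner_smul_left, real_inner_smul_left, smul_eq_mul]
    ring

theorem malliavinLaplacian_isFormalAdjoint (hΦ : IsGaussianField Φ) (hgen : GeneratesEvents Φ) :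
    (malliavinLaplacian Φ).IsFormalAdjoint (malliavinLaplacian Φ) :=
  opComp_adjoint_isFormalAdjoint (dense_domain_malliavin hΦ hgen) (isClosable_malliavin hΦ hgen)

theorem malliavinLaplacian_isClosed (hΦ : IsGaussianField Φ) (hgen : GeneratesEvents Φ) :
    (malliavinLaplacian Φ).IsClosed :=
  opComp_adjoint_isClosed (dense_domain_malliavin hΦ hgen) (isClosable_malliavin hΦ hgen)

end Chaos

/-! ### Transfer to the complexification -/

section ComplexifiedOperator

variable {Ω : Type*} [MeasurableSpace Ω] {P : Measure Ω}

theorem coeFn_reL2 (F : Lp ℂ 2 P) : ∀ᵐ ω ∂P, reL2 P F ω = (F ω).re :=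
  Complex.reCLM.coeFn_compLpL F

theorem coeFn_imL2 (F : Lp ℂ 2 P) : ∀ᵐ ω ∂P, imL2 P F ω = (F ω).im :=
  Complex.imCLM.coeFn_compLpL F

theorem coeFn_ofRealL2 (f : Lp ℝ 2 P) : ∀ᵐ ω ∂P, ofRealL2 P f ω = (f ω : ℂ) :=
  Complex.ofRealCLM.coeFn_compLpL f

theorem reL2_ofRealL2 (f : Lp ℝ 2 P) : reL2 P (ofRealL2 P f) = f := by
  refine Lp.ext ?_
  filter_upwards [coeFn_reL2 (ofRealL2 P f), coeFn_ofRealL2 f] with ω h1 h2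
  rw [h1, h2, Complex.ofReal_re]

theorem imL2_ofRealL2 (f : Lp ℝ 2 P) : imL2 P (ofRealL2 P f) = 0 := by
  refine Lp.ext ?_
  filter_upwards [coeFn_imL2 (ofRealL2 P f), coeFn_ofRealL2 f, Lp.coeFn_zero ℝ 2 P] with ω h1 h2 h3
  rw [h1, h2, Complex.ofReal_im, h3, Pi.zero_apply]

theorem ofRealL2_reL2_add (F : Lp ℂ 2 P) :
    ofRealL2 P (reL2 P F) + Complex.I • ofRealL2 P (imL2 P F) = F := by
  refine Lp.ext ?_
  filter_upwards [coeFn_reL2 F, coeFn_imL2 F, coeFn_ofRealL2 (reL2 P F),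
    coeFn_ofRealL2 (imL2 P F), Lp.coeFn_add (ofRealL2 P (reL2 P F))
      (Complex.I • ofRealL2 P (imL2 P F)), Lp.coeFn_smul Complex.I (ofRealL2 P (imL2 P F))]
    with ω h1 h2 h3 h4 h5 h6
  rw [h5, Pi.add_apply, h6, Pi.smul_apply, h3, h4, h1, h2, smul_eq_mul, mul_comm,
    Complex.re_add_im]

theorem reL2_ofRealL2_add (f g : Lp ℝ 2 P) :
    reL2 P (ofRealL2 P f + Complex.I • ofRealL2 P g) = f := by
  rw [map_add, reL2_smul, reL2_ofRealL2, imL2_ofRealL2]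
  simp

theorem imL2_ofRealL2_add (f g : Lp ℝ 2 P) :
    imL2 P (ofRealL2 P f + Complex.I • ofRealL2 P g) = g := by
  rw [map_add, imL2_smul, reL2_ofRealL2, imL2_ofRealL2, imL2_ofRealL2]
  simp

theorem inner_ofRealL2_ofRealL2 (f g : Lp ℝ 2 P) :
    inner ℂ (ofRealL2 P f) (ofRealL2 P g) = ((inner ℝ f g : ℝ) : ℂ) := by
  rw [L2.inner_def, L2.inner_def, ← integral_complex_ofReal]
  refine integral_congr_ae ?_
  filter_upwards [coeFn_ofRealL2 f, coeFn_ofRealL2 g] with ω h1 h2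
  rw [h1, h2]
  simp

/-- Reduces closedness, symmetry and eigenvectors of the complexified operator to the real operator.
-/
theorem mem_graph_complexify_iff (A : Lp ℝ 2 P →ₗ.[ℝ] Lp ℝ 2 P) (F G : Lp ℂ 2 P) :
    (F, G) ∈ (complexify A).graph ↔
      (reL2 P F, reL2 P G) ∈ A.graph ∧ (imL2 P F, imL2 P G) ∈ A.graph := by
  constructor
  · intro h
    obtain ⟨F, rfl, rfl⟩ := (LinearPMap.mem_graph_iff _).1 h
    change (reL2 P F, reL2 P (ofRealL2 P (A (reOn A.domain F)) +
        Complex.I • ofRealL2 P (A (imOn A.domain F)))) ∈ A.graph ∧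
      (imL2 P F, imL2 P (ofRealL2 P (A (reOn A.domain F)) +
        Complex.I • ofRealL2 P (A (imOn A.domain F)))) ∈ A.graph
    rw [reL2_ofRealL2_add, imL2_ofRealL2_add]
    exact ⟨A.mem_graph (reOn A.domain F), A.mem_graph (imOn A.domain F)⟩
  · rintro ⟨h1, h2⟩
    obtain ⟨f, hf, hf'⟩ := (LinearPMap.mem_graph_iff _).1 h1
    obtain ⟨g, hg, hg'⟩ := (LinearPMap.mem_graph_iff _).1 h2
    dsimp only at hf hf' hg hg'
    have hF : F ∈ complexifyDomain A.domain := ⟨hf ▸ f.2, hg ▸ g.2⟩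
    refine (LinearPMap.mem_graph_iff _).2 ⟨⟨F, hF⟩, rfl, ?_⟩
    change ofRealL2 P (A (reOn A.domain ⟨F, hF⟩)) +
        Complex.I • ofRealL2 P (A (imOn A.domain ⟨F, hF⟩)) = G
    rw [show reOn A.domain ⟨F, hF⟩ = f from Subtype.ext hf.symm,
      show imOn A.domain ⟨F, hF⟩ = g from Subtype.ext hg.symm, hf', hg', ofRealL2_reL2_add]

theorem complexify_isClosed {A : Lp ℝ 2 P →ₗ.[ℝ] Lp ℝ 2 P} (hA : A.IsClosed) :
    (complexify A).IsClosed := by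
  have h1 : IsClosed {x : Lp ℂ 2 P × Lp ℂ 2 P | (reL2 P x.1, reL2 P x.2) ∈ A.graph} :=
    IsClosed.preimage (f := fun x : Lp ℂ 2 P × Lp ℂ 2 P => (reL2 P x.1, reL2 P x.2))
      (by fun_prop) hA
  have h2 : IsClosed {x : Lp ℂ 2 P × Lp ℂ 2 P | (imL2 P x.1, imL2 P x.2) ∈ A.graph} :=
    IsClosed.preimage (f := fun x : Lp ℂ 2 P × Lp ℂ 2 P => (imL2 P x.1, imL2 P x.2))
      (by fun_prop) hA
  have h := h1.inter h2
  have heq : ((complexify A).graph : Set (Lp ℂ 2 P × Lp ℂ 2 P)) =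
      {x | (reL2 P x.1, reL2 P x.2) ∈ A.graph} ∩ {x | (imL2 P x.1, imL2 P x.2) ∈ A.graph} :=
    Set.ext fun x => mem_graph_complexify_iff A x.1 x.2
  rw [← heq] at h
  exact h

theorem complexify_isFormalAdjoint {A : Lp ℝ 2 P →ₗ.[ℝ] Lp ℝ 2 P} (hA : A.IsFormalAdjoint A) :
    (complexify A).IsFormalAdjoint (complexify A) := by
  intro F G
  obtain ⟨hF1, hF2⟩ := (mem_graph_complexify_iff A _ _).1 ((complexify A).mem_graph F)
  obtain ⟨hG1, hG2⟩ := (mem_graph_complexify_iff A _ _).1 ((complexify A).mem_graph G)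
  rw [← ofRealL2_reL2_add (F : Lp ℂ 2 P), ← ofRealL2_reL2_add (G : Lp ℂ 2 P),
    ← ofRealL2_reL2_add (complexify A F), ← ofRealL2_reL2_add (complexify A G)]
  simp only [inner_add_left, inner_add_right, inner_smul_left, inner_smul_right,
    inner_ofRealL2_ofRealL2]
  rw [inner_graph_eq hA hF1 hG1, inner_graph_eq hA hF1 hG2, inner_graph_eq hA hF2 hG1,
    inner_graph_eq hA hF2 hG2]

theorem ofRealL2_mem_opEigenspace_complexify {A : Lp ℝ 2 P →ₗ.[ℝ] Lp ℝ 2 P} {n : ℕ}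
    {f : Lp ℝ 2 P} (hf : f ∈ opEigenspace A (n : ℝ)) :
    ofRealL2 P f ∈ opEigenspace (complexify A) (n : ℂ) := by
  rw [mem_opEigenspace, mem_graph_complexify_iff, reL2_smul, imL2_smul, reL2_ofRealL2,
    imL2_ofRealL2, Complex.natCast_re, Complex.natCast_im, smul_zero, zero_smul, sub_zero, add_zero,
    smul_zero]
  exact ⟨mem_opEigenspace.1 hf, A.graph.zero_mem⟩

theorem opEigenspace_complexify_ne_bot {A : Lp ℝ 2 P →ₗ.[ℝ] Lp ℝ 2 P} {n : ℕ}
    (h : opEigenspace A (n : ℝ) ≠ ⊥) : opEigenspace (complexify A) (n : ℂ) ≠ ⊥ := by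
  obtain ⟨f, hf, hf0⟩ := (Submodule.ne_bot_iff _).1 h
  refine (Submodule.ne_bot_iff _).2 ⟨_, ofRealL2_mem_opEigenspace_complexify hf, fun h0 => hf0 ?_⟩
  rw [← reL2_ofRealL2 f, h0, map_zero]

theorem dense_iSup_opEigenspace_complexify {A : Lp ℝ 2 P →ₗ.[ℝ] Lp ℝ 2 P}
    (h : Dense ((⨆ n : ℕ, opEigenspace A (n : ℝ) : Submodule ℝ (Lp ℝ 2 P)) : Set (Lp ℝ 2 P))) :
    Dense ((⨆ n : ℕ, opEigenspace (complexify A) (n : ℂ) : Submodule ℂ (Lp ℂ 2 P)) :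
      Set (Lp ℂ 2 P)) := by
  set V := ⨆ n : ℕ, opEigenspace (complexify A) (n : ℂ)
  have h1 : ⨆ n : ℕ, opEigenspace A (n : ℝ) ≤
      (V.restrictScalars ℝ).comap (ofRealL2 P : Lp ℝ 2 P →ₗ[ℝ] Lp ℂ 2 P) := iSup_le fun n f hf =>
    Submodule.mem_iSup_of_mem (p := fun n : ℕ => opEigenspace (complexify A) (n : ℂ)) n
      (ofRealL2_mem_opEigenspace_complexify hf)
  have h2 : ∀ f, ofRealL2 P f ∈ V.topologicalClosure := fun f => by
    have hf : ofRealL2 P f ∈ closure (V : Set (Lp ℂ 2 P)) :=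
      map_mem_closure (ofRealL2 P).continuous (h f) fun x hx => h1 hx
    exact hf
  intro F
  rw [← ofRealL2_reL2_add F]
  exact V.topologicalClosure.add_mem (h2 _) (V.topologicalClosure.smul_mem _ (h2 _))

end ComplexifiedOperator

end

theorem mainTheorem7 {L : Type*} [NormedAddCommGroup L] [InnerProductSpace ℝ L]
    [CompleteSpace L] [Nontrivial L]
    {Ω : Type*} [MeasurableSpace Ω] (P : Measure Ω) [IsProbabilityMeasure P]
    (Φ : L →ₗ[ℝ] Lp ℝ 2 P) (hΦ : IsGaussianField Φ) (hgen : GeneratesEvents Φ) :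
    -- `T` is a well-defined, densely defined and closable operator, given by the formula on `𝒟`
    (malliavin Φ).graph = malliavinGraph Φ ∧
    (∀ (n : ℕ) (h : Fin n → L) (p : MvPolynomial (Fin n) ℝ),
      ∃ F : (malliavin Φ).domain,
        IsPolyField Φ h p F ∧ IsPolyFieldDeriv Φ h p (malliavin Φ F)) ∧
    Dense ((malliavin Φ).domain : Set (Lp ℝ 2 P)) ∧
    (malliavin Φ).IsClosable ∧
    -- `T* T̄` is selfadjoint, with spectrum `{0, 1, 2, …}`, also over the complex numbers
    IsSelfAdjoint (malliavinLaplacian Φ) ∧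
    opSpectrum (malliavinLaplacian Φ) = Set.range (fun n : ℕ => (n : ℝ)) ∧
    opSpectrum (complexify (malliavinLaplacian Φ)) = Set.range (fun n : ℕ => (n : ℂ)) := by
  have hsymm := malliavinLaplacian_isFormalAdjoint hΦ hgen
  have hcl := malliavinLaplacian_isClosed hΦ hgen
  have hd := dense_iSup_opEigenspace_malliavinLaplacian hΦ hgen
  have hne := opEigenspace_malliavinLaplacian_ne_bot hΦ hgen
  refine ⟨graph_malliavin hΦ, fun n h p => ?_, dense_domain_malliavin hΦ hgen,
    isClosable_malliavin hΦ hgen, isSelfAdjoint_of_dense_eigenspaces hsymm hcl hd,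
    opSpectrum_eq_range_natCast hsymm hcl hd hne,
    opSpectrum_eq_range_natCast (complexify_isFormalAdjoint hsymm) (complexify_isClosed hcl)
      (dense_iSup_opEigenspace_complexify hd) fun n => opEigenspace_complexify_ne_bot (hne n)⟩
  have hmem := mem_malliavinGraph_gradLp hΦ h p
  rw [← graph_malliavin hΦ] at hmem
  obtain ⟨F, hF, hF'⟩ := (LinearPMap.mem_graph_iff _).1 hmem
  dsimp only at hF hF'
  refine ⟨F, ?_, ?_⟩
  · rw [hF]
    exact isPolyField_polyLp hΦ h p
  · rw [hF']
    exact isPolyFieldDeriv_gradLp hΦ h p
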